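/- Let $Q$ be a group with identity $e$ and $P\subseteq Q$ a submonoid with $P\cap P^{-1}=\{e\}$; for $p,r\in P$ write $p\le r$ if $pq=r$ for some $q\in P$. Assume that $(Q,P)$ is a weakly quasi-lattice ordered group, i.e. any two elements of $P$ with a common upper bound in $P$ have a least common upper bound. Let $\Lambda$ be a $P$-graph: a countable small category, identified with its set of arrows (objects being identified with identity arrows; $\mu\nu$ is defined iff $s(\mu)=r(\nu)$), with a functor $d:\Lambda\to P$ such that whenever $d(\lambda)=pq$ with $p,q\in P$ there are unique $\mu,\nu$ with $\lambda=\mu\nu$, $d(\mu)=p$, $d(\nu)=q$. Write $\mu\preceq\lambda$ if $\lambda\in\mu\Lambda=\{\mu\nu: s(\mu)=r(\nu)\}$, and assume that $\Lambda$ is finitely aligned: for all $\mu,\nu\in\Lambda$ there is a finite $J\subseteq\Lambda$ with $\mu\Lambda\cap\nu\Lambda=\bigcup_{\lambda\in J}\lambda\Lambda$. A set $E\subseteq\Lambda$ is exhaustive if for every $\lambda$ with $r(\lambda)\in r(E)$ there is $\mu\in E$ with $\lambda\Lambda\cap\mu\Lambda\ne\emptyset$. *Filters.* Let $X_f$ be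 the set of filters of $\Lambda$, i.e. nonempty subsets $x$ that are hereditary ($\lambda\preceq\mu\in x$ implies $\lambda\in x$) and directed (any two elements of $x$ have a common upper bound for $\preceq$ in $x$), with the topology with basis the sets $\{x: K_1\subseteq x\subseteq\Lambda\setminus K_2\}$, $K_1,K_2\subseteq\Lambda$ finite. For $m\in P$, $x\cdot m$ is defined iff $x$ contains an (automatically unique) $\mu$ with $d(\mu)=m$, and then $x\cdot m=\{\nu: s(\mu)=r(\nu),\ \mu\nu\in x\}$. Let $\partial X_f$ be the closure in $X_f$ of the set of filters that are maximal under inclusion. *Graph morphisms.* For an increasing sequence $(m_n)$ in $P$, let $\Omega_{(m_n)}=\{(p,q)\in P\times P: p\le q\le m_n\text{ for some }n\}$, a category with composition $(p,q)(q,r)=(p,r)$ and degree functor $d(p,q)=p^{-1}q$. Let $X_m$ be the set of all degree-preserving functors $x:\Omega_x\to\Lambda$ whose domain $\Omega_x$ is of the form $\Omega_{(m_n)}$, put $e\Omega_x=\{(e,q)\in\Omega_x\}$, and give $X_m$ the topology with basis the sets $\{x:K_1\subseteq x(e\Omega_x)\subseteq\Lambda\setminus K_2\}$, $K_1,K_2\subseteq\Lambda$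 finite. For $m\in P$, $x\cdot m$ is defined iff $(e,m)\in\Omega_x$, and then $(x\cdot m)(p,q)=x(mp,mq)$ on $\{(p,q):(mp,mq)\in\Omega_x\}$. Let $\partial X_m$ be the set of $x\in X_m$ such that whenever $(e,m)\in\Omega_x$ and $E\subseteq\Lambda$ is finite and exhaustive with $s(x(e,m))\in r(E)$, there is $\nu\in E$ with $(m,m\,d(\nu))\in\Omega_x$ and $x(m,m\,d(\nu))=\nu$. *Groupoids.* For $X\in\{X_m,X_f\}$, let $G(X)$ be the set of $(x,q,y)\in X\times Q\times X$ for which there are $m,n\in P$ with $q=mn^{-1}$ and $x\cdot m=y\cdot n$ (both defined), with $(x,q,y)(y,r,z)=(x,qr,z)$, $(x,q,y)^{-1}=(y,q^{-1},x)$, and the topology generated by the sets $\{(x,mn^{-1},y)\in G(X): x\in U,\ y\in V,\ x\cdot m=y\cdot n\}$ with $m,n\in P$ and $U,V\subseteq X$ open. For $U\subseteq X$, let $G(X)|_U$ be the reduction of $G(X)$ to $\{(x,e,x):x\in U\}$, i.e. the subgroupoid of the arrows with source and range in that set, with the subspace topology. Call $U$ invariant if $x\cdot m=y\cdot n$ and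 $y\in U$ imply $x\in U$. **Statement.** $G(X_m)$ and $G(X_f)$ are topological groupoids, and the map $$\psi_h:G(X_m)\to G(X_f),\qquad (x,q,y)\mapsto (x(e\Omega_x),\,q,\,y(e\Omega_y)),$$ is a well-defined isomorphism of topological groupoids (a homeomorphism that preserves and reflects composability and preserves composition and inversion). The set $\partial X_m$ is closed in $X_m$ and invariant, and $\psi_h$ restricts to an isomorphism of topological groupoids from $G(X_m)|_{\partial X_m}$ onto $G(X_f)|_{\partial X_f}$. -/

import Mathlib

/-! ### Weakly quasi-lattice ordered groups -/

/-- The left-invariant relation `p ≤ r` on a monoid: `p * q = r` for some `q` in the monoid.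
This is divisibility in Mathlib. -/
abbrev PLe {M : Type*} [Monoid M] (p r : M) : Prop := p ∣ r

/-- `(Q, P)` is a weakly quasi-lattice ordered group: `P` is a submonoid of the group `Q` with
`P ∩ P⁻¹ = {e}`, and any two elements of `P` with a common upper bound in `P` have a least one. -/
structure IsWeaklyQuasiLatticeOrdered {Q : Type*} [Group Q] (P : Submonoid Q) : Prop where
  eq_one_of_inv_mem : ∀ p ∈ P, p⁻¹ ∈ P → p = 1
  exists_lub : ∀ p r : P, (∃ u : P, PLe p u ∧ PLe r u) →
    ∃ u : P, PLe p u ∧ PLe r u ∧ ∀ v : P, PLe p v → PLe r v → PLe u v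

/-! ### `P`-graphs -/

/-- The structure of a (discrete) `P`-graph on the set of arrows `Λ`, apart from countability: a
small category given by its arrows (an object is identified with its identity arrow, and
`comp μ ν` is the composite `μν`, defined if `s μ = r ν`), together with a degree functor
`d : Λ → P` that has the unique factorisation property. -/
structure PGraph {Q : Type*} [Group Q] (P : Submonoid Q) (Λ : Type*) where
  r : Λ → Λ
  s : Λ → Λ
  comp : ∀ μ ν : Λ, s μ = r ν → Λ
  r_r : ∀ μ, r (r μ) = r μ
  s_r : ∀ μ, s (r μ) = r μ
  r_s : ∀ μ, r (s μ) = s μ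
  s_s : ∀ μ, s (s μ) = s μ
  r_comp : ∀ μ ν h, r (comp μ ν h) = r μ
  s_comp : ∀ μ ν h, s (comp μ ν h) = s ν
  assoc : ∀ (lam μ ν : Λ) (h₁ : s lam = r μ) (h₂ : s μ = r ν),
    comp (comp lam μ h₁) ν ((s_comp lam μ h₁).trans h₂) =
      comp lam (comp μ ν h₂) (h₁.trans (r_comp μ ν h₂).symm)
  id_comp : ∀ μ, comp (r μ) μ (s_r μ) = μ
  comp_id : ∀ μ, comp μ (s μ) (r_s μ).symm = μ
  d : Λ → P
  d_r : ∀ μ, d (r μ) = 1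
  d_comp : ∀ μ ν h, d (comp μ ν h) = d μ * d ν
  factorisation : ∀ (lam : Λ) (p q : P), d lam = p * q →
    ∃! z : Λ × Λ, (∃ h : s z.1 = r z.2, lam = comp z.1 z.2 h) ∧ d z.1 = p ∧ d z.2 = q

namespace PGraph

variable {Q : Type*} [Group Q] {P : Submonoid Q} {Λ : Type*}

/-- `μ ≼ lam` if `μν = lam` for some `ν`. -/
def Prec (G : PGraph P Λ) (μ lam : Λ) : Prop :=
  ∃ (ν : Λ) (h : G.s μ = G.r ν), G.comp μ ν h = lam

/-- The set `μΛ` of all composites `μν`. -/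
def ideal (G : PGraph P Λ) (μ : Λ) : Set Λ := {lam | G.Prec μ lam}

def IsFinitelyAligned (G : PGraph P Λ) : Prop :=
  ∀ μ ν : Λ, ∃ J : Set Λ, J.Finite ∧ G.ideal μ ∩ G.ideal ν = ⋃ lam ∈ J, G.ideal lam

/-- `E` is exhaustive if every `lam` with `r lam ∈ r(E)` has a common extension with some
`μ ∈ E`. -/
def IsExhaustive (G : PGraph P Λ) (E : Set Λ) : Prop :=
  ∀ lam : Λ, G.r lam ∈ G.r '' E → ∃ μ ∈ E, (G.ideal lam ∩ G.ideal μ).Nonempty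

/-- `P`-graph morphisms: functors that preserve the degree. -/
structure IsMorphism {Λ₁ Λ₂ : Type*} (G₁ : PGraph P Λ₁) (G₂ : PGraph P Λ₂) (f : Λ₁ → Λ₂) :
    Prop where
  map_r : ∀ μ, f (G₁.r μ) = G₂.r (f μ)
  map_s : ∀ μ, f (G₁.s μ) = G₂.s (f μ)
  map_comp : ∀ (μ ν : Λ₁) (h : G₁.s μ = G₁.r ν) (h' : G₂.s (f μ) = G₂.r (f ν)),
    f (G₁.comp μ ν h) = G₂.comp (f μ) (f ν) h'
  map_d : ∀ μ, G₂.d (f μ) = G₁.d μ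

theorem comp_congr (G : PGraph P Λ) {μ μ' ν ν' : Λ} (h : G.s μ = G.r ν) (h' : G.s μ' = G.r ν')
    (e₁ : μ = μ') (e₂ : ν = ν') : G.comp μ ν h = G.comp μ' ν' h' := by
  subst e₁ e₂
  rfl

theorem fact_unique (G : PGraph P Λ) {μ ν μ' ν' : Λ} (h : G.s μ = G.r ν) (h' : G.s μ' = G.r ν')
    (e : G.comp μ ν h = G.comp μ' ν' h') (hd : G.d μ = G.d μ') : μ = μ' ∧ ν = ν' := by
  have h1 : G.d μ * G.d ν = G.d μ' * G.d ν' := by rw [← G.d_comp μ ν h, ← G.d_comp μ' ν' h', e]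
  have h2 : G.d ν = G.d ν' := by
    rw [hd] at h1
    exact mul_left_cancel h1
  have key := (G.factorisation (G.comp μ ν h) (G.d μ) (G.d ν) (G.d_comp μ ν h)).unique
    (y₁ := (μ, ν)) (y₂ := (μ', ν')) ⟨⟨h, rfl⟩, rfl, rfl⟩ ⟨⟨h', e⟩, hd.symm, h2.symm⟩
  exact ⟨congrArg Prod.fst key, congrArg Prod.snd key⟩

theorem prec_trans (G : PGraph P Λ) {a b c : Λ} (h₁ : G.Prec a b) (h₂ : G.Prec b c) :
    G.Prec a c := by
  obtain ⟨ν, hν, rfl⟩ := h₁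
  obtain ⟨κ, hκ, rfl⟩ := h₂
  exact ⟨_, _, (G.assoc a ν κ hν (by rw [← hκ, G.s_comp])).symm⟩

theorem r_prec (G : PGraph P Λ) (a : Λ) : G.Prec (G.r a) a := ⟨a, G.s_r a, G.id_comp a⟩

theorem r_eq_of_prec (G : PGraph P Λ) {a b : Λ} (h : G.Prec a b) : G.r b = G.r a := by
  obtain ⟨ν, hν, rfl⟩ := h
  exact G.r_comp _ _ _

theorem eq_r_of_d_eq_one (G : PGraph P Λ) {a : Λ} (h : G.d a = 1) : G.r a = a :=
  (G.fact_unique (G.s_r a) (G.r_s a).symm ((G.id_comp a).trans (G.comp_id a).symm)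
    ((G.d_r a).trans h.symm)).1

end PGraph

/-! ### Semigroup actions -/

/-- A semigroup action of a monoid `M` on a set `X` by partial maps: `dom x m` says that
`(x, m) ∈ X * M`, in which case `act x m _` is `x · m`. -/
structure PartialSemigroupAction (X M : Type*) [Monoid M] where
  dom : X → M → Prop
  act : ∀ (x : X) (m : M), dom x m → X
  dom_one : ∀ x, dom x 1
  act_one : ∀ x, act x 1 (dom_one x) = x
  dom_mul : ∀ x m n, dom x (m * n) ↔ ∃ h : dom x m, dom (act x m h) n
  act_mul : ∀ x m n (h : dom x m) (h' : dom (act x m h) n) (h'' : dom x (m * n)),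
    act (act x m h) n h' = act x (m * n) h''

namespace PartialSemigroupAction

/-- Directed semigroup actions. -/
def Directed {X M : Type*} [Monoid M] (A : PartialSemigroupAction X M) : Prop :=
  ∀ m n : M, (∃ x, A.dom x m ∧ A.dom x n) →
    ∃ l : M, PLe m l ∧ PLe n l ∧ ∀ x, A.dom x m → A.dom x n → A.dom x l

/-- `U` is invariant if `x · m = y · n` and `y ∈ U` imply `x ∈ U`. -/
def IsInvariant {X M : Type*} [Monoid M] (A : PartialSemigroupAction X M) (U : Set X) : Prop :=
  ∀ (x y : X) (m n : M) (hx : A.dom x m) (hy : A.dom y n),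
    y ∈ U → A.act x m hx = A.act y n hy → x ∈ U

end PartialSemigroupAction

/-! ### Groupoids -/

/-- A groupoid, given by its set `G` of arrows: `Comp g h` says that `(g, h)` is a composable
pair. -/
structure ArrowGroupoid (G : Type*) where
  Comp : G → G → Prop
  mul : ∀ g h : G, Comp g h → G
  inv : G → G
  assoc : ∀ (f g h : G) (h₁ : Comp f g) (h₂ : Comp g h),
    ∃ (h₃ : Comp f (mul g h h₂)) (h₄ : Comp (mul f g h₁) h),
      mul f (mul g h h₂) h₃ = mul (mul f g h₁) h h₄
  inv_inv : ∀ g, inv (inv g) = g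
  inv_comp : ∀ g, Comp (inv g) g
  inv_mul_cancel : ∀ (g h : G) (h₁ : Comp g h),
    ∃ h₂ : Comp (inv g) (mul g h h₁), mul (inv g) (mul g h h₁) h₂ = h
  mul_inv_cancel : ∀ (g h : G) (h₁ : Comp g h),
    ∃ h₂ : Comp (mul g h h₁) (inv h), mul (mul g h h₁) (inv h) h₂ = g

namespace ArrowGroupoid

variable {G H : Type*}

theorem comp_inv (𝒢 : ArrowGroupoid G) (g : G) : 𝒢.Comp g (𝒢.inv g) := by
  have h := 𝒢.inv_comp (𝒢.inv g)
  rwa [𝒢.inv_inv] at h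

/-- The range `g g⁻¹`. -/
def r (𝒢 : ArrowGroupoid G) (g : G) : G := 𝒢.mul g (𝒢.inv g) (𝒢.comp_inv g)

/-- The source `g⁻¹ g`. -/
def s (𝒢 : ArrowGroupoid G) (g : G) : G := 𝒢.mul (𝒢.inv g) g (𝒢.inv_comp g)

theorem mul_congr (𝒢 : ArrowGroupoid G) {g g' h h' : G} (c : 𝒢.Comp g h) (e₁ : g = g')
    (e₂ : h = h') : ∃ c' : 𝒢.Comp g' h', 𝒢.mul g h c = 𝒢.mul g' h' c' := by
  subst e₁ e₂
  exact ⟨c, rfl⟩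

theorem r_inv (𝒢 : ArrowGroupoid G) (g : G) : 𝒢.r (𝒢.inv g) = 𝒢.s g :=
  (𝒢.mul_congr (𝒢.comp_inv (𝒢.inv g)) rfl (𝒢.inv_inv g)).2

theorem s_inv (𝒢 : ArrowGroupoid G) (g : G) : 𝒢.s (𝒢.inv g) = 𝒢.r g :=
  (𝒢.mul_congr (𝒢.inv_comp (𝒢.inv g)) (𝒢.inv_inv g) rfl).2

theorem r_mul (𝒢 : ArrowGroupoid G) (g h : G) (c : 𝒢.Comp g h) :
    𝒢.r (𝒢.mul g h c) = 𝒢.r g := by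
  obtain ⟨c₁, e₁⟩ := 𝒢.inv_mul_cancel g h c
  obtain ⟨c₂, e₂⟩ := 𝒢.mul_inv_cancel _ _ c₁
  obtain ⟨c₃, e₃⟩ := 𝒢.mul_congr c₂ e₁ rfl
  obtain ⟨c₄, c₅, e₄⟩ := 𝒢.assoc g h _ c c₃
  obtain ⟨c₆, e₅⟩ := 𝒢.mul_congr c₄ rfl (e₃.symm.trans e₂)
  exact e₄.symm.trans e₅

theorem s_mul (𝒢 : ArrowGroupoid G) (g h : G) (c : 𝒢.Comp g h) :
    𝒢.s (𝒢.mul g h c) = 𝒢.s h := by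
  obtain ⟨c₁, e₁⟩ := 𝒢.mul_inv_cancel g h c
  obtain ⟨c₂, e₂⟩ := 𝒢.inv_mul_cancel _ _ c₁
  obtain ⟨c₃, e₃⟩ := 𝒢.mul_congr c₂ rfl e₁
  obtain ⟨c₄, c₅, e₄⟩ := 𝒢.assoc _ g h c₃ c
  obtain ⟨c₆, e₅⟩ := 𝒢.mul_congr c₅ (e₃.symm.trans e₂) rfl
  exact e₄.trans e₅

/-- The set `s⁻¹(U) ∩ r⁻¹(U)`. -/
def reductionSet (𝒢 : ArrowGroupoid G) (U : Set G) : Set G := {g | 𝒢.s g ∈ U ∧ 𝒢.r g ∈ U}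

/-- The reduction of a groupoid to a set `U` of units, with the inherited operations. -/
def reduction (𝒢 : ArrowGroupoid G) (U : Set G) : ArrowGroupoid (𝒢.reductionSet U) where
  Comp g h := 𝒢.Comp g h
  mul g h c := ⟨𝒢.mul g h c, by
    refine ⟨?_, ?_⟩
    · rw [s_mul]
      exact h.2.1
    · rw [r_mul]
      exact g.2.2⟩
  inv g := ⟨𝒢.inv g, by
    refine ⟨?_, ?_⟩
    · rw [s_inv]
      exact g.2.2
    · rw [r_inv]
      exact g.2.1⟩
  assoc f g h c₁ c₂ := by
    obtain ⟨c₃, c₄, e⟩ := 𝒢.assoc f g h c₁ c₂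
    exact ⟨c₃, c₄, Subtype.ext e⟩
  inv_inv g := Subtype.ext (𝒢.inv_inv g)
  inv_comp g := 𝒢.inv_comp g
  inv_mul_cancel g h c := by
    obtain ⟨c', e⟩ := 𝒢.inv_mul_cancel g h c
    exact ⟨c', Subtype.ext e⟩
  mul_inv_cancel g h c := by
    obtain ⟨c', e⟩ := 𝒢.mul_inv_cancel g h c
    exact ⟨c', Subtype.ext e⟩

/-- A groupoid with a topology is topological if composition (on the composable pairs, with the
subspace topology) and inversion are continuous. -/
structure IsTopological [TopologicalSpace G] (𝒢 : ArrowGroupoid G) : Prop where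
  continuous_mul :
    Continuous fun z : {z : G × G // 𝒢.Comp z.1 z.2} => 𝒢.mul z.1.1 z.1.2 z.2
  continuous_inv : Continuous 𝒢.inv

/-- Isomorphisms of topological groupoids. -/
structure IsTopIso [TopologicalSpace G] [TopologicalSpace H] (𝒢 : ArrowGroupoid G)
    (ℋ : ArrowGroupoid H) (ψ : G → H) : Prop where
  isHomeomorph : IsHomeomorph ψ
  comp_iff : ∀ g h, 𝒢.Comp g h ↔ ℋ.Comp (ψ g) (ψ h)
  map_mul : ∀ (g h : G) (c : 𝒢.Comp g h) (c' : ℋ.Comp (ψ g) (ψ h)),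
    ψ (𝒢.mul g h c) = ℋ.mul (ψ g) (ψ h) c'
  map_inv : ∀ g, ψ (𝒢.inv g) = ℋ.inv (ψ g)

end ArrowGroupoid

/-! ### Semidirect product groupoids -/

/-- The set of `(x, q, y) ∈ X × Q × X` for which there are `m, n ∈ P` with `q = m n⁻¹` and
`x · m = y · n` (both defined). -/
@[ext]
structure SemidirectArrows {Q : Type*} [Group Q] {P : Submonoid Q} {X : Type*}
    (A : PartialSemigroupAction X P) where
  rng : X
  deg : Q
  src : X
  mem : ∃ (m n : P) (hx : A.dom rng m) (hy : A.dom src n),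
    deg = (m : Q) * (n : Q)⁻¹ ∧ A.act rng m hx = A.act src n hy

namespace SemidirectArrows

variable {Q : Type*} [Group Q] {P : Submonoid Q} {X : Type*}

/-- The set of all `(x, m n⁻¹, y)` with `x ∈ U`, `y ∈ V` and `x · m = y · n`. -/
def cylinder (A : PartialSemigroupAction X P) (U : Set X) (m n : P) (V : Set X) :
    Set (SemidirectArrows A) :=
  {g | g.deg = (m : Q) * (n : Q)⁻¹ ∧ g.rng ∈ U ∧ g.src ∈ V ∧
    ∃ (hx : A.dom g.rng m) (hy : A.dom g.src n), A.act g.rng m hx = A.act g.src n hy}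

/-- The topology generated by the sets `cylinder A U m n V` with `U` and `V` open. -/
instance [TopologicalSpace X] (A : PartialSemigroupAction X P) :
    TopologicalSpace (SemidirectArrows A) :=
  TopologicalSpace.generateFrom
    {Z | ∃ (U V : Set X) (m n : P), IsOpen U ∧ IsOpen V ∧ Z = cylinder A U m n V}

theorem mem_mul {A : PartialSemigroupAction X P} (hA : A.Directed) (g h : SemidirectArrows A)
    (c : g.src = h.rng) : ∃ (m n : P) (hx : A.dom g.rng m) (hy : A.dom h.src n),
      g.deg * h.deg = (m : Q) * (n : Q)⁻¹ ∧ A.act g.rng m hx = A.act h.src n hy := by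
  obtain ⟨x, q, y, m, n, hx, hy, hq, e⟩ := g
  obtain ⟨y', q', z, k, l, hy', hz, hq', e'⟩ := h
  dsimp only at c hx hy hy' hz e e' hq hq' ⊢
  subst c
  obtain ⟨p, ⟨n', hn'⟩, ⟨k', hk'⟩, hp⟩ := hA n k ⟨y, hy, hy'⟩
  have hyp := hp y hy hy'
  have h1 : A.dom y (n * n') := hn' ▸ hyp
  have h2 : A.dom y (k * k') := hk' ▸ hyp
  obtain ⟨_, h1'⟩ := (A.dom_mul y n n').1 h1
  obtain ⟨_, h2'⟩ := (A.dom_mul y k k').1 h2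
  have h3 : A.dom (A.act x m hx) n' := by rw [e]; exact h1'
  have h4 : A.dom (A.act z l hz) k' := by rw [← e']; exact h2'
  refine ⟨m * n', l * k', (A.dom_mul _ _ _).2 ⟨hx, h3⟩, (A.dom_mul _ _ _).2 ⟨hz, h4⟩, ?_, ?_⟩
  · have hnk : (n : Q) * n' = k * k' := by
      rw [← Submonoid.coe_mul, ← Submonoid.coe_mul, ← hn', ← hk']
    have : (n : Q)⁻¹ * k = n' * (k' : Q)⁻¹ := by
      rw [inv_mul_eq_iff_eq_mul, ← mul_assoc, hnk, mul_inv_cancel_right]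
    rw [hq, hq', Submonoid.coe_mul, Submonoid.coe_mul, mul_inv_rev, mul_assoc,
      ← mul_assoc (n : Q)⁻¹, this]
    group
  · rw [← A.act_mul x m n' hx h3, ← A.act_mul z l k' hz h4]
    have t1 : A.act (A.act x m hx) n' h3 = A.act (A.act y n hy) n' h1' := by congr 1
    have t2 : A.act (A.act z l hz) k' h4 = A.act (A.act y k hy') k' h2' := by
      congr 1
      exact e'.symm
    rw [t1, t2, A.act_mul y n n' hy h1' h1, A.act_mul y k k' hy' h2' h2]
    congr 1
    rw [← hn', ← hk']

/-- The semidirect product groupoid of a directed semigroup action: `(x, q, y)` and `(w, r, z)`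
are composable if `y = w`, with composite `(x, q r, z)`, and the inverse of `(x, q, y)` is
`(y, q⁻¹, x)`. -/
def groupoid (A : PartialSemigroupAction X P) (hA : A.Directed) :
    ArrowGroupoid (SemidirectArrows A) where
  Comp g h := g.src = h.rng
  mul g h c := ⟨g.rng, g.deg * h.deg, h.src, mem_mul hA g h c⟩
  inv g := ⟨g.src, g.deg⁻¹, g.rng, by
    obtain ⟨m, n, hx, hy, hq, e⟩ := g.mem
    exact ⟨n, m, hy, hx, by rw [hq, mul_inv_rev, inv_inv], e.symm⟩⟩
  assoc f g h h₁ h₂ := ⟨h₁, h₂, by simp [mul_assoc]⟩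
  inv_inv g := by simp
  inv_comp g := rfl
  inv_mul_cancel g h c := ⟨rfl, by ext <;> simp [c]⟩
  mul_inv_cancel g h c := ⟨rfl, by ext <;> simp [c]⟩

/-- The set of units `(x, e, x)` with `x ∈ U`. -/
def units (A : PartialSemigroupAction X P) (U : Set X) : Set (SemidirectArrows A) :=
  {g | g.rng ∈ U ∧ g.deg = 1 ∧ g.src = g.rng}

end SemidirectArrows

/-! ### Filters -/

/-- The path space of filters: nonempty, hereditary and directed sets of arrows. -/
@[ext]
structure FilterPath {Q : Type*} [Group Q] {P : Submonoid Q} {Λ : Type*} (G : PGraph P Λ) where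
  carrier : Set Λ
  nonempty : carrier.Nonempty
  hereditary : ∀ lam μ, G.Prec lam μ → μ ∈ carrier → lam ∈ carrier
  directed : ∀ μ ∈ carrier, ∀ ν ∈ carrier, ∃ lam ∈ carrier, G.Prec μ lam ∧ G.Prec ν lam

namespace FilterPath

variable {Q : Type*} [Group Q] {P : Submonoid Q} {Λ : Type*} {G : PGraph P Λ}

/-- The topology with basis the sets `{x | K₁ ⊆ x ⊆ Λ \ K₂}`, where `K₁` and `K₂` are finite. -/
instance : TopologicalSpace (FilterPath G) :=
  TopologicalSpace.generateFrom
    {Z | ∃ K₁ K₂ : Set Λ, K₁.Finite ∧ K₂.Finite ∧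
      Z = {x : FilterPath G | K₁ ⊆ x.carrier ∧ x.carrier ⊆ K₂ᶜ}}

/-- The filter of all `ν` with `μν ∈ x`, where `μ ∈ x`. -/
def shift (x : FilterPath G) (μ : Λ) (hμ : μ ∈ x.carrier) : FilterPath G where
  carrier := {ν | ∃ h : G.s μ = G.r ν, G.comp μ ν h ∈ x.carrier}
  nonempty := ⟨G.s μ, (G.r_s μ).symm, by rw [G.comp_id]; exact hμ⟩
  hereditary := by
    rintro lam _ ⟨κ, hκ, rfl⟩ ⟨h, hx⟩
    have h' : G.s μ = G.r lam := by rw [h, G.r_comp]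
    refine ⟨h', x.hereditary _ _ ?_ hx⟩
    exact ⟨κ, by rw [G.s_comp, hκ], G.assoc μ lam κ h' hκ⟩
  directed := by
    rintro α ⟨hα, hxα⟩ β ⟨hβ, hxβ⟩
    obtain ⟨lam, hlam, ⟨γ, hγ, e₁⟩, ⟨δ, hδ, e₂⟩⟩ := x.directed _ hxα _ hxβ
    have hγ' : G.s α = G.r γ := by rw [← hγ, G.s_comp]
    have hδ' : G.s β = G.r δ := by rw [← hδ, G.s_comp]
    have a₁ := G.assoc μ α γ hα hγ'
    have a₂ := G.assoc μ β δ hβ hδ'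
    have e : G.comp α γ hγ' = G.comp β δ hδ' :=
      (G.fact_unique _ _ ((a₁.symm.trans (e₁.trans e₂.symm)).trans a₂) rfl).2
    exact ⟨G.comp α γ hγ', ⟨hα.trans (G.r_comp _ _ _).symm, by rw [← a₁, e₁]; exact hlam⟩,
      ⟨γ, hγ', rfl⟩, ⟨δ, hδ', e.symm⟩⟩

/-- The degree is injective on a filter. -/
theorem eq_of_d_eq (x : FilterPath G) {μ ν : Λ} (hμ : μ ∈ x.carrier) (hν : ν ∈ x.carrier)
    (h : G.d μ = G.d ν) : μ = ν := by
  obtain ⟨lam, _, ⟨γ, hγ, e₁⟩, ⟨δ, hδ, e₂⟩⟩ := x.directed _ hμ _ hν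
  exact (G.fact_unique hγ hδ (e₁.trans e₂.symm) h).1

/-- `(x, m)` belongs to the domain of the action if `x` contains an arrow of degree `m`. -/
def Dom (x : FilterPath G) (m : P) : Prop := ∃ μ, μ ∈ x.carrier ∧ G.d μ = m

/-- `x · m` is the shift of `x` by its unique element of degree `m`. -/
noncomputable def act (x : FilterPath G) (m : P) (h : x.Dom m) : FilterPath G :=
  x.shift h.choose h.choose_spec.1

theorem act_eq (x : FilterPath G) (m : P) (h : x.Dom m) (μ : Λ) (hμ : μ ∈ x.carrier)
    (hd : G.d μ = m) : x.act m h = x.shift μ hμ := by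
  have e : h.choose = μ := x.eq_of_d_eq h.choose_spec.1 hμ (h.choose_spec.2.trans hd.symm)
  unfold act
  congr 1

end FilterPath

section

variable {Q : Type*} [Group Q] {P : Submonoid Q} {Λ : Type*}

/-- The action of `P` on the path space of filters. -/
noncomputable def filterAction (G : PGraph P Λ) : PartialSemigroupAction (FilterPath G) P where
  dom x m := x.Dom m
  act x m h := x.act m h
  dom_one x := by
    obtain ⟨a, ha⟩ := x.nonempty
    exact ⟨G.r a, x.hereditary _ _ (G.r_prec a) ha, G.d_r a⟩
  act_one x := by
    obtain ⟨a, ha⟩ := x.nonempty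
    have hr : G.r a ∈ x.carrier := x.hereditary _ _ (G.r_prec a) ha
    rw [x.act_eq 1 _ (G.r a) hr (G.d_r a)]
    ext ν
    constructor
    · rintro ⟨h, hν⟩
      have e : G.comp (G.r a) ν h = ν :=
        (G.comp_congr h (G.s_r ν) (by rw [← h, G.s_r]) rfl).trans (G.id_comp ν)
      rwa [e] at hν
    · intro hν
      obtain ⟨lam, _, h₁, h₂⟩ := x.directed _ ha _ hν
      have h : G.s (G.r a) = G.r ν := by
        rw [G.s_r, ← G.r_eq_of_prec h₁, ← G.r_eq_of_prec h₂]
      refine ⟨h, ?_⟩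
      have e : G.comp (G.r a) ν h = ν :=
        (G.comp_congr h (G.s_r ν) (by rw [← h, G.s_r]) rfl).trans (G.id_comp ν)
      rwa [e]
  dom_mul x m n := by
    constructor
    · rintro ⟨lam, hlam, hd⟩
      obtain ⟨⟨μ, ν⟩, ⟨⟨h, rfl⟩, hμ, hν⟩, -⟩ := G.factorisation lam m n hd
      have hx : μ ∈ x.carrier := x.hereditary _ _ ⟨ν, h, rfl⟩ hlam
      have hD : x.Dom m := ⟨μ, hx, hμ⟩
      refine ⟨hD, ?_⟩
      rw [x.act_eq m hD μ hx hμ]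
      exact ⟨ν, ⟨h, hlam⟩, hν⟩
    · rintro ⟨hD, h⟩
      obtain ⟨μ, hx, hμ⟩ := id hD
      rw [x.act_eq m hD μ hx hμ] at h
      obtain ⟨ν, ⟨h, hlam⟩, hν⟩ := h
      exact ⟨_, hlam, by rw [G.d_comp, hμ, hν]⟩
  act_mul x m n h h' h'' := by
    obtain ⟨μ, hx, hμ⟩ := id h
    have h₁ : (x.shift μ hx).Dom n := by
      rw [← x.act_eq m h μ hx hμ]
      exact h'
    obtain ⟨ν, hν, hdν⟩ := id h₁
    have e₁ : (x.act m h).act n h' = (x.shift μ hx).act n h₁ := by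
      congr 1
      exact x.act_eq m h μ hx hμ
    rw [e₁, (x.shift μ hx).act_eq n h₁ ν hν hdν,
      x.act_eq (m * n) h'' (G.comp μ ν hν.1) hν.2 (by rw [G.d_comp, hμ, hdν])]
    ext κ
    constructor
    · rintro ⟨a, b, c⟩
      refine ⟨by rw [G.s_comp, a], ?_⟩
      rw [G.assoc μ ν κ hν.1 a]
      exact c
    · rintro ⟨a, c⟩
      have a' : G.s ν = G.r κ := by rw [← a, G.s_comp]
      refine ⟨a', hν.1.trans (G.r_comp _ _ _).symm, ?_⟩
      rw [← G.assoc μ ν κ hν.1 a']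
      exact c

theorem filterAction_directed (hP : IsWeaklyQuasiLatticeOrdered P) (G : PGraph P Λ) :
    (filterAction G).Directed := by
  have key : ∀ (x : FilterPath G) (m n : P), x.Dom m → x.Dom n →
      ∃ v : P, PLe m v ∧ PLe n v ∧ x.Dom v := by
    rintro x m n ⟨μ, hμ, rfl⟩ ⟨ν, hν, rfl⟩
    obtain ⟨lam, hlam, ⟨γ, hγ, e₁⟩, ⟨δ, hδ, e₂⟩⟩ := x.directed _ hμ _ hν
    exact ⟨G.d lam, ⟨G.d γ, by rw [← e₁, G.d_comp]⟩, ⟨G.d δ, by rw [← e₂, G.d_comp]⟩,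
      lam, hlam, rfl⟩
  rintro m n ⟨x, hm, hn⟩
  obtain ⟨v, h₁, h₂, -⟩ := key x m n hm hn
  obtain ⟨u, hu₁, hu₂, hu⟩ := hP.exists_lub m n ⟨v, h₁, h₂⟩
  refine ⟨u, hu₁, hu₂, fun y hy₁ hy₂ => ?_⟩
  obtain ⟨w, hw₁, hw₂, hw⟩ := key y m n hy₁ hy₂
  obtain ⟨t, rfl⟩ := hu w hw₁ hw₂
  exact (((filterAction G).dom_mul y u t).1 hw).1

/-- The boundary-path space of filters: the closure of the set of ultrafilters, i.e. of the
filters that are maximal with respect to inclusion. -/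
def filterBoundary (G : PGraph P Λ) : Set (FilterPath G) :=
  closure {x | ∀ y : FilterPath G, x.carrier ⊆ y.carrier → x = y}

/-! ### Graph morphisms -/

/-- The set of all `(p, q) ∈ P × P` with `p ≤ q ≤ m`. -/
def omegaFin (m : P) : Set (P × P) := {z | PLe z.1 z.2 ∧ PLe z.2 m}

/-- The union of the sets `omegaFin (m n)`, `n ∈ ℕ`. -/
def omegaSet (m : ℕ → P) : Set (P × P) := ⋃ n, omegaFin (m n)

theorem mem_omegaSet {m : ℕ → P} {z : P × P} :
    z ∈ omegaSet m ↔ PLe z.1 z.2 ∧ ∃ n, PLe z.2 (m n) := by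
  simp [omegaSet, omegaFin]

theorem inv_mul_mem_of_pLe {p q : P} (h : PLe p q) : (p : Q)⁻¹ * q ∈ P := by
  obtain ⟨c, rfl⟩ := h
  simp

/-- The `P`-graph structure on `omegaSet m`: the pairs `(p, q)` and `(q, r)` compose to `(p, r)`,
and the degree of `(p, q)` is `p⁻¹ q`. -/
def omega (m : ℕ → P) : PGraph P (omegaSet m) where
  r z := ⟨(z.1.1, z.1.1), by
    obtain ⟨h, n, hn⟩ := mem_omegaSet.1 z.2
    exact mem_omegaSet.2 ⟨dvd_rfl, n, dvd_trans h hn⟩⟩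
  s z := ⟨(z.1.2, z.1.2), by
    obtain ⟨h, n, hn⟩ := mem_omegaSet.1 z.2
    exact mem_omegaSet.2 ⟨dvd_rfl, n, hn⟩⟩
  comp z w h := ⟨(z.1.1, w.1.2), by
    obtain ⟨h₁, -⟩ := mem_omegaSet.1 z.2
    obtain ⟨h₂, n, hn⟩ := mem_omegaSet.1 w.2
    have e : z.1.2 = w.1.1 := congrArg (fun t => t.1.1) h
    exact mem_omegaSet.2 ⟨dvd_trans h₁ (e ▸ h₂), n, hn⟩⟩
  r_r _ := rfl
  s_r _ := rfl
  r_s _ := rfl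
  s_s _ := rfl
  r_comp _ _ _ := rfl
  s_comp _ _ _ := rfl
  assoc _ _ _ _ _ := rfl
  id_comp _ := rfl
  comp_id _ := rfl
  d z := ⟨(z.1.1 : Q)⁻¹ * z.1.2, inv_mul_mem_of_pLe (mem_omegaSet.1 z.2).1⟩
  d_r z := Subtype.ext (inv_mul_cancel _)
  d_comp z w h := by
    have e : z.1.2 = w.1.1 := congrArg (fun t => t.1.1) h
    apply Subtype.ext
    simp [e, mul_assoc]
  factorisation := by
    rintro ⟨⟨a, b⟩, hz⟩ p q hd
    obtain ⟨hab, n, hn⟩ := mem_omegaSet.1 hz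
    have hd' : (a : Q)⁻¹ * b = p * q := congrArg Subtype.val hd
    have hb : b = a * p * q := by
      apply Subtype.ext
      rw [inv_mul_eq_iff_eq_mul] at hd'
      simp [hd', mul_assoc]
    have h₂ : PLe (a * p) b := ⟨q, hb⟩
    refine ⟨(⟨(a, a * p), mem_omegaSet.2 ⟨dvd_mul_right _ _, n, dvd_trans h₂ hn⟩⟩,
      ⟨(a * p, b), mem_omegaSet.2 ⟨h₂, n, hn⟩⟩), ⟨⟨rfl, rfl⟩, ?_, ?_⟩, ?_⟩
    · apply Subtype.ext
      simp
    · apply Subtype.ext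
      simp [hb, mul_assoc]
    · rintro ⟨⟨⟨a', c⟩, h₁⟩, ⟨⟨c', b'⟩, h₂⟩⟩ ⟨⟨hs, e⟩, hp, hq⟩
      have hc : c = c' := congrArg (fun t => t.1.1) hs
      have ha : a = a' := congrArg (fun t => t.1.1) e
      have hb' : b = b' := congrArg (fun t => t.1.2) e
      subst hc ha hb'
      have hp' : (a : Q)⁻¹ * c = p := congrArg Subtype.val hp
      have hcp : c = a * p := by
        apply Subtype.ext
        rw [inv_mul_eq_iff_eq_mul] at hp'
        simp [hp']
      subst hcp
      rfl

/-- The path space of graph morphisms: all `P`-graph morphisms from a direct limit `omega m`,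
where `m` is an increasing sequence in `P`, to the given `P`-graph. The sequence is not part of the
data: two such morphisms are equal if they have the same domain and the same values. -/
structure MorphismPath (G : PGraph P Λ) where
  dom : Set (P × P)
  toFun : dom → Λ
  exists_seq : ∃ m : ℕ → P, (∀ i j, i < j → PLe (m i) (m j)) ∧ ∃ h : dom = omegaSet m,
    (omega m).IsMorphism G fun z => toFun ⟨z.1, h ▸ z.2⟩

namespace MorphismPath

variable {G : PGraph P Λ}

theorem ext' {x y : MorphismPath G} (h₁ : ∀ z, z ∈ x.dom ↔ z ∈ y.dom)
    (h₂ : ∀ z hx hy, x.toFun ⟨z, hx⟩ = y.toFun ⟨z, hy⟩) : x = y := by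
  obtain ⟨D, f, _⟩ := x
  obtain ⟨D', f', _⟩ := y
  obtain rfl : D = D' := Set.ext h₁
  obtain rfl : f = f' := funext fun z => h₂ z.1 z.2 z.2
  rfl

/-- The set `x(e dom(x))` of all values `x(e, q)`. -/
def initialSet (x : MorphismPath G) : Set Λ := {lam | ∃ (q : P) (h : (1, q) ∈ x.dom),
  x.toFun ⟨(1, q), h⟩ = lam}

/-- The topology with basis the sets `{x | K₁ ⊆ x(e dom(x)) ⊆ Λ \ K₂}`, where `K₁` and `K₂` are
finite. -/
instance : TopologicalSpace (MorphismPath G) :=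
  TopologicalSpace.generateFrom
    {Z | ∃ K₁ K₂ : Set Λ, K₁.Finite ∧ K₂.Finite ∧
      Z = {x : MorphismPath G | K₁ ⊆ x.initialSet ∧ x.initialSet ⊆ K₂ᶜ}}

/-- The morphism `x · m`, given by `(x · m)(p, q) = x(mp, mq)`. -/
def act (x : MorphismPath G) (m : P) (hm : (1, m) ∈ x.dom) : MorphismPath G where
  dom := {z | (m * z.1, m * z.2) ∈ x.dom}
  toFun z := x.toFun ⟨(m * z.1.1, m * z.1.2), z.2⟩
  exists_seq := by
    obtain ⟨D, f, k, hk, rfl, hf⟩ := x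
    dsimp only at hm hf ⊢
    obtain ⟨-, N, hN⟩ := mem_omegaSet.1 hm
    have hmono : ∀ i j, i ≤ j → PLe (k i) (k j) := by
      intro i j hij
      rcases hij.eq_or_lt with rfl | h
      · exact dvd_rfl
      · exact hk i j h
    have hex : ∀ n, ∃ c : P, k (n + N) = m * c := fun n =>
      dvd_trans hN (hmono N (n + N) (Nat.le_add_left _ _))
    choose c hc using hex
    have hdiv : ∀ a b : P, PLe (m * a) (m * b) ↔ PLe a b := by
      intro a b
      constructor
      · rintro ⟨t, ht⟩
        exact ⟨t, mul_left_cancel (ht.trans (mul_assoc m a t))⟩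
      · exact mul_dvd_mul_left m
    have hdom : ∀ z : P × P, (m * z.1, m * z.2) ∈ omegaSet k ↔ z ∈ omegaSet c := by
      intro z
      rw [mem_omegaSet, mem_omegaSet, hdiv]
      refine and_congr_right fun _ => ⟨?_, ?_⟩
      · rintro ⟨n, hn⟩
        refine ⟨n, (hdiv _ _).1 ?_⟩
        rw [← hc]
        exact dvd_trans hn (hmono _ _ (Nat.le_add_right _ _))
      · rintro ⟨n, hn⟩
        refine ⟨n + N, ?_⟩
        rw [hc]
        exact (hdiv _ _).2 hn
    refine ⟨c, fun i j hij => (hdiv _ _).1 ?_, Set.ext hdom, ?_⟩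
    · rw [← hc, ← hc]
      exact hk _ _ (by omega)
    · refine ⟨fun z => ?_, fun z => ?_, fun z w h h' => ?_, fun z => ?_⟩
      · exact hf.map_r ⟨_, (hdom z.1).2 z.2⟩
      · exact hf.map_s ⟨_, (hdom z.1).2 z.2⟩
      · have e : z.1.2 = w.1.1 := congrArg (fun t => t.1.1) h
        refine hf.map_comp ⟨_, (hdom z.1).2 z.2⟩ ⟨_, (hdom w.1).2 w.2⟩ ?_ h'
        exact Subtype.ext (by simp [_root_.omega, e])
      · refine (hf.map_d ⟨_, (hdom z.1).2 z.2⟩).trans ?_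
        exact Subtype.ext (by simp [_root_.omega, mul_assoc])

end MorphismPath

/-- The action of `P` on the path space of graph morphisms. -/
def morphismAction (G : PGraph P Λ) : PartialSemigroupAction (MorphismPath G) P where
  dom x m := (1, m) ∈ x.dom
  act x m h := x.act m h
  dom_one x := by
    obtain ⟨m, -, hd, -⟩ := x.exists_seq
    rw [hd, mem_omegaSet]
    exact ⟨dvd_rfl, 0, one_dvd _⟩
  act_one x := MorphismPath.ext' (fun z => by simp [MorphismPath.act])
    (fun z hx hy => by simp [MorphismPath.act])
  dom_mul x m n := by
    obtain ⟨k, -, hd, -⟩ := x.exists_seq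
    simp only [MorphismPath.act, Set.mem_ofPred_eq, mul_one, exists_prop]
    rw [hd, mem_omegaSet, mem_omegaSet, mem_omegaSet]
    constructor
    · rintro ⟨-, j, hj⟩
      exact ⟨⟨one_dvd _, j, dvd_trans (dvd_mul_right _ _) hj⟩, dvd_mul_right _ _, j, hj⟩
    · rintro ⟨-, -, j, hj⟩
      exact ⟨one_dvd _, j, hj⟩
  act_mul x m n h h' h'' := MorphismPath.ext'
    (fun z => by simp [MorphismPath.act, mul_assoc])
    (fun z hx hy => by simp [MorphismPath.act, mul_assoc])

theorem morphismAction_directed (hP : IsWeaklyQuasiLatticeOrdered P) (G : PGraph P Λ) :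
    (morphismAction G).Directed := by
  have key : ∀ (x : MorphismPath G) (m n : P), (1, m) ∈ x.dom → (1, n) ∈ x.dom →
      ∃ v : P, PLe m v ∧ PLe n v ∧ (1, v) ∈ x.dom := by
    intro x m n hm hn
    obtain ⟨k, hk, hd, -⟩ := x.exists_seq
    rw [hd, mem_omegaSet] at hm hn
    obtain ⟨-, i, hi⟩ := hm
    obtain ⟨-, j, hj⟩ := hn
    have hmono : ∀ i j, i ≤ j → PLe (k i) (k j) := by
      intro i j hij
      rcases hij.eq_or_lt with rfl | h
      · exact dvd_rfl
      · exact hk i j h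
    refine ⟨k (max i j), dvd_trans hi (hmono _ _ (le_max_left _ _)),
      dvd_trans hj (hmono _ _ (le_max_right _ _)), ?_⟩
    rw [hd, mem_omegaSet]
    exact ⟨one_dvd _, _, dvd_rfl⟩
  rintro m n ⟨x, hm, hn⟩
  obtain ⟨v, h₁, h₂, -⟩ := key x m n hm hn
  obtain ⟨u, hu₁, hu₂, hu⟩ := hP.exists_lub m n ⟨v, h₁, h₂⟩
  refine ⟨u, hu₁, hu₂, fun y hy₁ hy₂ => ?_⟩
  obtain ⟨w, hw₁, hw₂, hw⟩ := key y m n hy₁ hy₂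
  obtain ⟨t, rfl⟩ := hu w hw₁ hw₂
  exact (((morphismAction G).dom_mul y u t).1 hw).1

/-- The boundary-path space of graph morphisms: all `x` such that, whenever `(e, m)` is in the
domain of `x` and `E` is finite and exhaustive with `s(x(e, m)) ∈ r(E)`, there is `ν ∈ E` with
`x(m, m d(ν)) = ν` (in particular `(m, m d(ν))` is in the domain of `x`). -/
def morphismBoundary (G : PGraph P Λ) : Set (MorphismPath G) :=
  {x | ∀ (m : P) (hm : (1, m) ∈ x.dom) (E : Set Λ), E.Finite → G.IsExhaustive E →
    G.s (x.toFun ⟨(1, m), hm⟩) ∈ G.r '' E →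
    ∃ ν ∈ E, ∃ h : (m, m * G.d ν) ∈ x.dom, x.toFun ⟨(m, m * G.d ν), h⟩ = ν}

/-! ### Path groupoids and boundary-path groupoids -/

/-- The path groupoid of graph morphisms. -/
def morphismPathGroupoid (hP : IsWeaklyQuasiLatticeOrdered P) (G : PGraph P Λ) :
    ArrowGroupoid (SemidirectArrows (morphismAction G)) :=
  SemidirectArrows.groupoid (morphismAction G) (morphismAction_directed hP G)

/-- The path groupoid of filters. -/
noncomputable def filterPathGroupoid (hP : IsWeaklyQuasiLatticeOrdered P) (G : PGraph P Λ) :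
    ArrowGroupoid (SemidirectArrows (filterAction G)) :=
  SemidirectArrows.groupoid (filterAction G) (filterAction_directed hP G)

/-- The set of arrows of the boundary-path groupoid of graph morphisms. -/
def morphismBoundaryArrows (hP : IsWeaklyQuasiLatticeOrdered P) (G : PGraph P Λ) :
    Set (SemidirectArrows (morphismAction G)) :=
  (morphismPathGroupoid hP G).reductionSet
    (SemidirectArrows.units (morphismAction G) (morphismBoundary G))

/-- The boundary-path groupoid of graph morphisms. -/
def morphismBoundaryGroupoid (hP : IsWeaklyQuasiLatticeOrdered P) (G : PGraph P Λ) :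
    ArrowGroupoid (morphismBoundaryArrows hP G) :=
  (morphismPathGroupoid hP G).reduction
    (SemidirectArrows.units (morphismAction G) (morphismBoundary G))

/-- The set of arrows of the boundary-path groupoid of filters. -/
def filterBoundaryArrows (hP : IsWeaklyQuasiLatticeOrdered P) (G : PGraph P Λ) :
    Set (SemidirectArrows (filterAction G)) :=
  (filterPathGroupoid hP G).reductionSet
    (SemidirectArrows.units (filterAction G) (filterBoundary G))

/-- The boundary-path groupoid of filters. -/
noncomputable def filterBoundaryGroupoid (hP : IsWeaklyQuasiLatticeOrdered P) (G : PGraph P Λ) :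
    ArrowGroupoid (filterBoundaryArrows hP G) :=
  (filterPathGroupoid hP G).reduction
    (SemidirectArrows.units (filterAction G) (filterBoundary G))

end

/-! A graph morphism `x` is determined by the filter of its values `x(e, q)`: that filter has at
most one element of each degree, and unique factorisation recovers `x(p, q)` from `x(e, p) x(p, q) =
x(e, q)`. Conversely, a filter of a countable category has an increasing cofinal sequence, whose
degrees define the domain of a morphism. Since the basic open sets on both sides are described by
the same sets of arrows, `toFilter` is a homeomorphism; it also intertwines the two actions
(`isHomeomorph_toFilter`, `isEquivariant_toFilter`). An equivariant homeomorphism induces an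
isomorphism of semidirect product groupoids (`isTopIso_map`), so only one of the two needs to be
shown topological. On filters, elements of `P` act by continuous, locally injective maps with open
domains, which suffices (`isTopological_groupoid`).

For the boundaries, the condition defining `morphismBoundary` is carried to tightness: a filter
passes through every finite exhaustive set placed at the source of any of its elements. The closure
of the maximal filters is exactly the set of tight filters (`mem_filterBoundary_iff`). Tightness is
a closed condition, and a maximal filter is tight because it can otherwise be enlarged by a limit of
principal filters along an ultrafilter on `ℕ`. Conversely, finite alignment turns the exclusions in
a basic neighbourhood of a tight filter into a finite set that cannot be exhaustive; an arrow
avoiding it leads to a maximal filter in the neighbourhood. Closedness and invariance of the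
boundary of morphisms are then inherited from tight filters. -/

/-! ### Partial actions and equivariant maps -/

namespace PartialSemigroupAction

variable {X Y M : Type*} [Monoid M]

/-- Maps that preserve and reflect the domain of a semigroup action and commute with it. -/
structure IsEquivariant (A : PartialSemigroupAction X M) (B : PartialSemigroupAction Y M)
    (f : X → Y) : Prop where
  dom_iff : ∀ x m, A.dom x m ↔ B.dom (f x) m
  map_act : ∀ x m (h : A.dom x m) (h' : B.dom (f x) m), f (A.act x m h) = B.act (f x) m h'

/-- Semigroup actions by continuous, locally injective maps with open domains. -/
structure IsContinuousLocallyInjective [TopologicalSpace X] (A : PartialSemigroupAction X M) :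
    Prop where
  isOpen_preimage : ∀ (m : M) (W : Set X), IsOpen W → IsOpen {x | ∃ h : A.dom x m, A.act x m h ∈ W}
  exists_injective_nhd : ∀ (x : X) (m : M), A.dom x m → ∃ W : Set X, IsOpen W ∧ x ∈ W ∧
    ∀ y ∈ W, ∀ z ∈ W, ∀ (hy : A.dom y m) (hz : A.dom z m), A.act y m hy = A.act z m hz → y = z

theorem act_congr (A : PartialSemigroupAction X M) {x y : X} {m n : M} (e₁ : x = y) (e₂ : m = n)
    (hx : A.dom x m) (hy : A.dom y n) : A.act x m hx = A.act y n hy := by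
  subst e₁ e₂
  rfl

/-- If `x · a = y · b` and `x · a` is in the domain of `t`, then `x · at = y · bt`. -/
theorem act_mul_eq_act_mul (A : PartialSemigroupAction X M) {x y : X} {a b t : M} (hx : A.dom x a)
    (hy : A.dom y b) (e : A.act x a hx = A.act y b hy) (h : A.dom x (a * t)) :
    ∃ h' : A.dom y (b * t), A.act x (a * t) h = A.act y (b * t) h' := by
  obtain ⟨_, h₁⟩ := (A.dom_mul x a t).1 h
  have h₂ : A.dom (A.act y b hy) t := e ▸ h₁
  refine ⟨(A.dom_mul y b t).2 ⟨hy, h₂⟩, ?_⟩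
  rw [← A.act_mul x a t hx h₁ h, ← A.act_mul y b t hy h₂]
  exact A.act_congr e rfl _ _

end PartialSemigroupAction

/-! ### Semidirect product groupoids: functoriality and topology -/

namespace SemidirectArrows

variable {Q : Type*} [Group Q] {P : Submonoid Q} {X Y : Type*}

/-- The map `(x, q, y) ↦ (f x, q, f y)` for an equivariant map `f`. -/
def map {A : PartialSemigroupAction X P} {B : PartialSemigroupAction Y P} (f : X → Y)
    (hf : A.IsEquivariant B f) (g : SemidirectArrows A) : SemidirectArrows B where
  rng := f g.rng
  deg := g.deg
  src := f g.src
  mem := by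
    obtain ⟨m, n, hx, hy, hq, e⟩ := g.mem
    refine ⟨m, n, (hf.dom_iff _ _).1 hx, (hf.dom_iff _ _).1 hy, hq, ?_⟩
    rw [← hf.map_act _ _ hx, ← hf.map_act _ _ hy, e]

theorem map_bijective {A : PartialSemigroupAction X P} {B : PartialSemigroupAction Y P} {f : X → Y}
    (hf : A.IsEquivariant B f) (hb : Function.Bijective f) : Function.Bijective (map f hf) := by
  constructor
  · intro g h e
    exact SemidirectArrows.ext (hb.1 (congrArg rng e)) (congrArg (deg (A := B)) e) (hb.1 (congrArg src e))
  · rintro ⟨x, q, y, m, n, hx, hy, hq, e⟩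
    obtain ⟨x, rfl⟩ := hb.2 x
    obtain ⟨y, rfl⟩ := hb.2 y
    refine ⟨⟨x, q, y, m, n, (hf.dom_iff _ _).2 hx, (hf.dom_iff _ _).2 hy, hq, hb.1 ?_⟩, rfl⟩
    rw [hf.map_act _ _ _ hx, hf.map_act _ _ _ hy, e]

theorem preimage_map_cylinder {A : PartialSemigroupAction X P} {B : PartialSemigroupAction Y P}
    {f : X → Y} (hf : A.IsEquivariant B f) (hi : Function.Injective f) (U V : Set Y) (m n : P) :
    map f hf ⁻¹' cylinder B U m n V = cylinder A (f ⁻¹' U) m n (f ⁻¹' V) := by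
  ext g
  refine and_congr_right fun _ => and_congr_right fun _ => and_congr_right fun _ => ⟨?_, ?_⟩
  · rintro ⟨hx, hy, e⟩
    refine ⟨(hf.dom_iff _ _).2 hx, (hf.dom_iff _ _).2 hy, hi ?_⟩
    rw [hf.map_act _ _ _ hx, hf.map_act _ _ _ hy]
    exact e
  · rintro ⟨hx, hy, e⟩
    refine ⟨(hf.dom_iff _ _).1 hx, (hf.dom_iff _ _).1 hy, ?_⟩
    have := congrArg f e
    rwa [hf.map_act _ _ _ ((hf.dom_iff _ _).1 hx), hf.map_act _ _ _ ((hf.dom_iff _ _).1 hy)]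
      at this

/-- Every open set of `X` is the preimage of one of `Y`, so the cylinders of `A` are exactly the
preimages of the cylinders of `B`: the topology on the arrows of `A` is the induced one. -/
theorem isHomeomorph_map [TopologicalSpace X] [TopologicalSpace Y]
    {A : PartialSemigroupAction X P} {B : PartialSemigroupAction Y P} {f : X → Y}
    (hf : A.IsEquivariant B f) (hh : IsHomeomorph f) : IsHomeomorph (map f hf) := by
  refine isHomeomorph_iff_isEmbedding_surjective.2
    ⟨⟨⟨?_⟩, (map_bijective hf hh.bijective).1⟩, (map_bijective hf hh.bijective).2⟩
  refine Eq.trans ?_ induced_generateFrom_eq.symm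
  refine congrArg TopologicalSpace.generateFrom (Set.ext fun Z => ⟨?_, ?_⟩)
  · rintro ⟨U, V, m, n, hU, hV, rfl⟩
    obtain ⟨U, hU', rfl⟩ := hh.isInducing.isOpen_iff.1 hU
    obtain ⟨V, hV', rfl⟩ := hh.isInducing.isOpen_iff.1 hV
    exact ⟨_, ⟨U, V, m, n, hU', hV', rfl⟩, preimage_map_cylinder hf hh.injective U V m n⟩
  · rintro ⟨_, ⟨U, V, m, n, hU, hV, rfl⟩, rfl⟩
    exact ⟨_, _, m, n, hU.preimage hh.continuous, hV.preimage hh.continuous,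
      preimage_map_cylinder hf hh.injective U V m n⟩

theorem isTopIso_map [TopologicalSpace X] [TopologicalSpace Y]
    {A : PartialSemigroupAction X P} {B : PartialSemigroupAction Y P} (hA : A.Directed)
    (hB : B.Directed) {f : X → Y} (hf : A.IsEquivariant B f) (hh : IsHomeomorph f) :
    (groupoid A hA).IsTopIso (groupoid B hB) (map f hf) where
  isHomeomorph := isHomeomorph_map hf hh
  comp_iff _ _ := hh.injective.eq_iff.symm
  map_mul _ _ _ _ := rfl
  map_inv _ := rfl

theorem mem_reductionSet_units {A : PartialSemigroupAction X P} (hA : A.Directed) (U : Set X)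
    (g : SemidirectArrows A) :
    g ∈ (groupoid A hA).reductionSet (units A U) ↔ g.src ∈ U ∧ g.rng ∈ U := by
  simp [ArrowGroupoid.reductionSet, ArrowGroupoid.r, ArrowGroupoid.s, groupoid, units]

theorem isOpen_cylinder [TopologicalSpace X] (A : PartialSemigroupAction X P) {U V : Set X}
    (hU : IsOpen U) (m n : P) (hV : IsOpen V) : IsOpen (cylinder A U m n V) :=
  TopologicalSpace.isOpen_generateFrom_of_mem ⟨U, V, m, n, hU, hV, rfl⟩

theorem inv_preimage_cylinder {A : PartialSemigroupAction X P} (hA : A.Directed) (U V : Set X)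
    (m n : P) : (groupoid A hA).inv ⁻¹' cylinder A U m n V = cylinder A V n m U := by
  ext g
  constructor
  · rintro ⟨hq, hU, hV, hx, hy, e⟩
    refine ⟨?_, hV, hU, hy, hx, e.symm⟩
    rw [← inv_inv g.deg]
    exact (congrArg _ hq).trans (by simp)
  · rintro ⟨hq, hU, hV, hx, hy, e⟩
    refine ⟨?_, hV, hU, hy, hx, e.symm⟩
    change g.deg⁻¹ = _
    rw [hq]
    simp

/-- Two representations of an arrow `(x, q, z)`, of which the second persists near `x` and `z`:
if `x · m = z · n`, then `x' · a = z' · b` with `a b⁻¹ = m n⁻¹` implies `x' · m = z' · n` for all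
`x'` and `z'` near `x` and `z`. -/
theorem exists_nhds_act_eq_act [TopologicalSpace X] {A : PartialSemigroupAction X P}
    (hA : A.Directed) (hc : A.IsContinuousLocallyInjective) {x z : X} {m n a b : P}
    (hm : A.dom x m) (hn : A.dom z n) (e : A.act x m hm = A.act z n hn) (ha : A.dom x a)
    (hq : (a : Q) * (b : Q)⁻¹ = m * (n : Q)⁻¹) :
    ∃ U V : Set X, IsOpen U ∧ IsOpen V ∧ x ∈ U ∧ z ∈ V ∧ ∀ x' ∈ U, ∀ z' ∈ V,
      ∀ (hx : A.dom x' a) (hz : A.dom z' b), A.act x' a hx = A.act z' b hz →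
      ∃ (hx' : A.dom x' m) (hz' : A.dom z' n), A.act x' m hx' = A.act z' n hz' := by
  obtain ⟨l, ⟨s, hs⟩, ⟨t, ht⟩, hl⟩ := hA a m ⟨x, ha, hm⟩
  have hst : a * s = m * t := hs.symm.trans ht
  -- The hypothesis `hq` says `m⁻¹ a = n⁻¹ b`, so the same `s` and `t` that equalise `a` and `m`
  -- equalise `b` and `n`.
  have hst' : b * s = n * t := by
    have h₁ : (a : Q) * s = m * t := congrArg Subtype.val hst
    apply Subtype.ext
    have h₂ : (b : Q)⁻¹ = (a : Q)⁻¹ * m * (n : Q)⁻¹ := by rw [mul_assoc, ← hq]; simp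
    have h₃ : (b : Q) = n * (m : Q)⁻¹ * a := by
      rw [← inv_inv (b : Q), h₂]
      simp [mul_assoc]
    rw [Submonoid.coe_mul, Submonoid.coe_mul, h₃, mul_assoc, h₁]
    simp [mul_assoc]
  have hxl : A.dom x (m * t) := ht ▸ hl x ha hm
  obtain ⟨_, hwt⟩ := (A.dom_mul x m t).1 hxl
  -- For nearby `x'` and `z'`, both `x' · m` and `z' · n` will lie in `W`, where acting by `t` is
  -- injective; and `x' · mt = x' · as = z' · bs = z' · nt`.
  obtain ⟨W, hW, hxW, hinj⟩ := hc.exists_injective_nhd _ t hwt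
  have hdom : ∀ {k : P}, IsOpen {x | A.dom x k} := by
    intro k
    have := hc.isOpen_preimage k Set.univ isOpen_univ
    simpa using this
  refine ⟨{x' | ∃ h : A.dom x' m, A.act x' m h ∈ W} ∩ {x' | A.dom x' (m * t)},
    {z' | ∃ h : A.dom z' n, A.act z' n h ∈ W},
    (hc.isOpen_preimage m W hW).inter hdom, hc.isOpen_preimage n W hW, ⟨⟨hm, hxW⟩, hxl⟩,
    ⟨hn, e ▸ hxW⟩, ?_⟩
  rintro x' ⟨⟨hx', hxW'⟩, hxl'⟩ z' ⟨hz', hzW'⟩ hx hz e'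
  refine ⟨hx', hz', ?_⟩
  obtain ⟨hzl', e''⟩ := A.act_mul_eq_act_mul hx hz e' (t := s) (hst ▸ hxl')
  have hzl : A.dom z' (n * t) := hst' ▸ hzl'
  obtain ⟨_, h₁⟩ := (A.dom_mul x' m t).1 hxl'
  obtain ⟨_, h₂⟩ := (A.dom_mul z' n t).1 hzl
  refine hinj _ hxW' _ hzW' h₁ h₂ ?_
  rw [A.act_mul x' m t hx' h₁ hxl', A.act_mul z' n t hz' h₂ hzl]
  refine (A.act_congr rfl hst.symm _ _).trans (e''.trans (A.act_congr rfl hst' _ _))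

/-- For multiplication, a product in the cylinder of `(m, n)` is first represented through
representations of its two factors. The latter persist on cylinders around the factors, and
`exists_nhds_act_eq_act` converts them back to `(m, n)` uniformly nearby. -/
theorem isTopological_groupoid [TopologicalSpace X] {A : PartialSemigroupAction X P}
    (hA : A.Directed) (hc : A.IsContinuousLocallyInjective) : (groupoid A hA).IsTopological where
  continuous_inv := by
    refine continuous_generateFrom_iff.2 ?_
    rintro _ ⟨U, V, m, n, hU, hV, rfl⟩
    rw [inv_preimage_cylinder]
    exact isOpen_cylinder A hV n m hU
  continuous_mul := by
    refine continuous_generateFrom_iff.2 ?_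
    rintro _ ⟨U, V, m, n, hU, hV, rfl⟩
    refine isOpen_iff_mem_nhds.2 ?_
    rintro ⟨⟨g, h⟩, c⟩ ⟨hq, hgU, hhV, hm, hn, e⟩
    dsimp only [groupoid] at c hq hgU hhV hm hn e
    obtain ⟨a, b, hga, hgb, hgq, hge⟩ := g.mem
    obtain ⟨c', d, hhc, hhd, hhq, hhe⟩ := h.mem
    have hhb : A.dom g.src c' := c ▸ hhc
    -- A common bound `bs = c't` at the middle unit represents the product by `(as, dt)`.
    obtain ⟨l, ⟨s, hs⟩, ⟨t, ht⟩, hl⟩ := hA b c' ⟨g.src, hgb, hhb⟩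
    have hbs : A.dom g.src (b * s) := hs ▸ hl _ hgb hhb
    have has : A.dom g.rng (a * s) := (A.act_mul_eq_act_mul hgb hga hge.symm hbs).1
    have hst : b * s = c' * t := hs.symm.trans ht
    have hdeg : g.deg * h.deg = ((a * s : P) : Q) * ((d * t : P) : Q)⁻¹ := by
      have h₁ : (b : Q) * s = c' * t := congrArg Subtype.val hst
      have h₂ : (b : Q)⁻¹ * c' = s * (t : Q)⁻¹ := by
        rw [inv_mul_eq_iff_eq_mul, ← mul_assoc, h₁, mul_inv_cancel_right]
      rw [hgq, hhq, Submonoid.coe_mul, Submonoid.coe_mul, mul_inv_rev, mul_assoc,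
        ← mul_assoc (b : Q)⁻¹, h₂]
      simp [mul_assoc]
    obtain ⟨U', V', hU', hV', hgU', hhV', key⟩ :=
      exists_nhds_act_eq_act hA hc hm hn e has (b := d * t) (hdeg.symm.trans hq)
    have hfst : Continuous fun z : {z : SemidirectArrows A × SemidirectArrows A //
      (groupoid A hA).Comp z.1 z.2} => z.1.1 := continuous_fst.comp continuous_subtype_val
    have hsnd : Continuous fun z : {z : SemidirectArrows A × SemidirectArrows A //
      (groupoid A hA).Comp z.1 z.2} => z.1.2 := continuous_snd.comp continuous_subtype_val
    -- Requiring the middle unit to stay in the domain of `bs` keeps the representation `(as, dt)`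
    -- available for all nearby composable pairs.
    have hdom : IsOpen {x | A.dom x (b * s)} := by
      simpa using hc.isOpen_preimage (b * s) Set.univ isOpen_univ
    have h₁ := (isOpen_cylinder A (hU.inter hU') a b hdom).preimage hfst
    have h₂ := (isOpen_cylinder A isOpen_univ c' d (hV.inter hV')).preimage hsnd
    refine Filter.mem_of_superset ((h₁.inter h₂).mem_nhds
      ⟨⟨hgq, ⟨hgU, hgU'⟩, hbs, hga, hgb, hge⟩, ⟨hhq, trivial, ⟨hhV, hhV'⟩, hhc, hhd, hhe⟩⟩) ?_
    rintro ⟨⟨g₁, h₁⟩, c₁⟩ ⟨⟨hq₁, ⟨hU₁, hU₁'⟩, hbs₁, ha₁, hb₁, e₁⟩,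
      ⟨hq₂, -, ⟨hV₂, hV₂'⟩, hc₂, hd₂, e₂⟩⟩
    dsimp only [groupoid] at c₁ hq₁ hU₁ hU₁' hbs₁ ha₁ hb₁ e₁ hq₂ hV₂ hV₂' hc₂ hd₂ e₂
    obtain ⟨has₁, e₁'⟩ := A.act_mul_eq_act_mul hb₁ ha₁ e₁.symm hbs₁
    have hct : A.dom h₁.rng (c' * t) := c₁ ▸ hst ▸ hbs₁
    obtain ⟨hdt, e₂'⟩ := A.act_mul_eq_act_mul hc₂ hd₂ e₂ hct
    obtain ⟨hx, hz, e₃⟩ := key _ hU₁' _ hV₂' has₁ hdt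
      (e₁'.symm.trans ((A.act_congr c₁ hst _ _).trans e₂'))
    refine ⟨?_, hU₁, hV₂, hx, hz, e₃⟩
    rw [← hq, hgq, hhq, ← hq₁, ← hq₂]
    rfl

end SemidirectArrows

namespace ArrowGroupoid

variable {G H : Type*} [TopologicalSpace G] [TopologicalSpace H]

theorem IsTopIso.isTopological {𝒢 : ArrowGroupoid G} {ℋ : ArrowGroupoid H} {ψ : G → H}
    (h : 𝒢.IsTopIso ℋ ψ) (hℋ : ℋ.IsTopological) : 𝒢.IsTopological where
  continuous_mul := by
    refine h.isHomeomorph.isInducing.continuous_iff.2 ?_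
    have hc : Continuous fun z : {z : G × G // 𝒢.Comp z.1 z.2} =>
        (⟨(ψ z.1.1, ψ z.1.2), (h.comp_iff _ _).1 z.2⟩ : {z : H × H // ℋ.Comp z.1 z.2}) := by
      have := h.isHomeomorph.continuous
      fun_prop
    exact (hℋ.continuous_mul.comp hc).congr fun z =>
      (h.map_mul _ _ _ ((h.comp_iff _ _).1 z.2)).symm
  continuous_inv := by
    refine h.isHomeomorph.isInducing.continuous_iff.2 ?_
    exact (hℋ.continuous_inv.comp h.isHomeomorph.continuous).congr fun g => (h.map_inv g).symm

theorem IsTopIso.reduction {𝒢 : ArrowGroupoid G} {ℋ : ArrowGroupoid H} {ψ : G → H}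
    (h : 𝒢.IsTopIso ℋ ψ) {U : Set G} {V : Set H} (hψ : Set.MapsTo ψ (𝒢.reductionSet U)
      (ℋ.reductionSet V)) (hs : ∀ g, ψ g ∈ ℋ.reductionSet V → g ∈ 𝒢.reductionSet U) :
    (𝒢.reduction U).IsTopIso (ℋ.reduction V) hψ.restrict where
  isHomeomorph := by
    refine isHomeomorph_iff_isEmbedding_surjective.2 ⟨?_, ?_⟩
    · refine Topology.IsEmbedding.of_comp
        (h.isHomeomorph.continuous.restrict hψ) continuous_subtype_val ?_
      exact h.isHomeomorph.isEmbedding.comp Topology.IsEmbedding.subtypeVal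
    · rintro ⟨y, hy⟩
      obtain ⟨g, rfl⟩ := h.isHomeomorph.surjective y
      exact ⟨⟨g, hs g hy⟩, rfl⟩
  comp_iff g k := h.comp_iff g k
  map_mul g k c c' := Subtype.ext (h.map_mul g k c c')
  map_inv g := Subtype.ext (h.map_inv g)

end ArrowGroupoid

/-! ### Finite alignment and exhaustive sets -/

open Filter in
theorem Ultrafilter.exists_mem_eventually_of_finite {ι α : Type*} (U : Ultrafilter ι) {J : Set α}
    (hJ : J.Finite) {p : α → ι → Prop} (h : ∀ᶠ i in U, ∃ a ∈ J, p a i) :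
    ∃ a ∈ J, ∀ᶠ i in U, p a i := by
  refine (Ultrafilter.finite_biUnion_mem_iff hJ (s := fun a => {i | p a i})).1 ?_
  refine Filter.mem_of_superset h fun i hi => ?_
  simpa using hi

namespace PGraph

variable {Q : Type*} [Group Q] {P : Submonoid Q} {Λ : Type*}

theorem prec_refl (G : PGraph P Λ) (a : Λ) : G.Prec a a := ⟨G.s a, (G.r_s a).symm, G.comp_id a⟩

theorem prec_comp (G : PGraph P Λ) {a b : Λ} (h : G.s a = G.r b) : G.Prec a (G.comp a b h) :=
  ⟨b, h, rfl⟩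

theorem comp_left_cancel (G : PGraph P Λ) {a b c : Λ} (hb : G.s a = G.r b) (hc : G.s a = G.r c)
    (e : G.comp a b hb = G.comp a c hc) : b = c :=
  (G.fact_unique hb hc e rfl).2

theorem comp_prec_comp (G : PGraph P Λ) {a b c : Λ} (h : G.Prec b c) (hb : G.s a = G.r b)
    (hc : G.s a = G.r c) : G.Prec (G.comp a b hb) (G.comp a c hc) := by
  obtain ⟨k, hk, rfl⟩ := h
  exact ⟨k, by rw [G.s_comp, hk], G.assoc a b k hb hk⟩

theorem prec_of_comp_prec_comp (G : PGraph P Λ) {a b c : Λ} (hb : G.s a = G.r b)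
    (hc : G.s a = G.r c) (h : G.Prec (G.comp a b hb) (G.comp a c hc)) : G.Prec b c := by
  obtain ⟨k, hk, e⟩ := h
  have hk' : G.s b = G.r k := by rw [← hk, G.s_comp]
  exact ⟨k, hk', G.comp_left_cancel (hb.trans (G.r_comp _ _ _).symm) hc
    ((G.assoc a b k hb hk').symm.trans e)⟩

theorem exists_comp_of_comp_prec (G : PGraph P Λ) {a b c : Λ} (hb : G.s a = G.r b)
    (h : G.Prec (G.comp a b hb) c) : ∃ (k : Λ) (hk : G.s a = G.r k), G.comp a k hk = c ∧
      G.Prec b k := by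
  obtain ⟨k, hk, rfl⟩ := h
  have hk' : G.s b = G.r k := by rw [← hk, G.s_comp]
  exact ⟨_, hb.trans (G.r_comp _ _ _).symm, (G.assoc a b k hb hk').symm, G.prec_comp hk'⟩

/-- Finitely many arrows `γ` extend `β` to all common extensions of `β` and `ν`. -/
theorem IsFinitelyAligned.exists_finite_extensions {G : PGraph P Λ} (hG : G.IsFinitelyAligned)
    (β ν : Λ) : ∃ F : Set Λ, F.Finite ∧
      (∀ γ ∈ F, ∃ h : G.s β = G.r γ, G.Prec ν (G.comp β γ h)) ∧
      ∀ (γ : Λ) (h : G.s β = G.r γ), G.Prec ν (G.comp β γ h) → ∃ γ' ∈ F, G.Prec γ' γ := by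
  obtain ⟨J, hJ, e⟩ := hG β ν
  -- The initial segment `β` is removed from the members of `J`; by left cancellation each of them
  -- yields at most one `γ`.
  refine ⟨⋃ lam ∈ J, {γ | ∃ h : G.s β = G.r γ, G.comp β γ h = lam}, ?_, ?_, ?_⟩
  · refine hJ.biUnion fun lam _ => Set.Subsingleton.finite ?_
    rintro γ ⟨h, rfl⟩ γ' ⟨h', e'⟩
    exact (G.comp_left_cancel h' h e').symm
  · intro γ hγ
    simp only [Set.mem_iUnion] at hγ
    obtain ⟨_, hlam, h, rfl⟩ := hγ
    have : G.comp β γ h ∈ G.ideal β ∩ G.ideal ν := by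
      rw [e]
      exact Set.mem_biUnion hlam (G.prec_refl _)
    exact ⟨h, this.2⟩
  · intro γ h hν
    have : G.comp β γ h ∈ G.ideal β ∩ G.ideal ν := ⟨G.prec_comp h, hν⟩
    rw [e] at this
    simp only [Set.mem_iUnion] at this
    obtain ⟨lam, hlam, hlam'⟩ := this
    have hβ : lam ∈ G.ideal β ∩ G.ideal ν := by
      rw [e]
      exact Set.mem_biUnion hlam (G.prec_refl _)
    obtain ⟨γ', h', rfl⟩ := hβ.1
    refine ⟨γ', ?_, G.prec_of_comp_prec_comp h' h hlam'⟩
    simp only [Set.mem_iUnion]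
    exact ⟨_, hlam, h', rfl⟩

/-- A finite exhaustive set can be pulled back along an arrow. -/
theorem IsFinitelyAligned.exists_exhaustive {G : PGraph P Λ} (hG : G.IsFinitelyAligned)
    {E : Set Λ} (hE : E.Finite) (hex : G.IsExhaustive E) {β : Λ} (hβ : G.r β ∈ G.r '' E) :
    ∃ F : Set Λ, F.Finite ∧ G.IsExhaustive F ∧ G.s β ∈ G.r '' F ∧
      ∀ γ ∈ F, ∃ ν ∈ E, ∃ h : G.s β = G.r γ, G.Prec ν (G.comp β γ h) := by
  choose F hF hF₁ hF₂ using hG.exists_finite_extensions β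
  -- Exhaustiveness of `E` is applied to `β lam`: a common extension with some `ν ∈ E` has the form
  -- `βk`, and `k` extends both `lam` and one of the finitely many `γ`.
  have key : ∀ lam, G.s β = G.r lam → ∃ γ ∈ ⋃ ν ∈ E, F ν, (G.ideal lam ∩ G.ideal γ).Nonempty := by
    intro lam h
    obtain ⟨ν, hν, κ, h₁, h₂⟩ := hex (G.comp β lam h) (by rwa [G.r_comp])
    obtain ⟨k, hk, rfl, h₃⟩ := G.exists_comp_of_comp_prec h h₁
    obtain ⟨γ, hγ, hγk⟩ := hF₂ ν k hk h₂
    exact ⟨γ, Set.mem_biUnion hν hγ, k, h₃, hγk⟩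
  have hr : ∀ γ ∈ ⋃ ν ∈ E, F ν, ∃ ν ∈ E, ∃ h : G.s β = G.r γ, G.Prec ν (G.comp β γ h) := by
    intro γ hγ
    simp only [Set.mem_iUnion] at hγ
    obtain ⟨ν, hν, hγ⟩ := hγ
    exact ⟨ν, hν, hF₁ ν γ hγ⟩
  refine ⟨⋃ ν ∈ E, F ν, hE.biUnion fun ν _ => hF ν, ?_, ?_, hr⟩
  · rintro lam ⟨γ, hγ, e⟩
    obtain ⟨_, _, h, _⟩ := hr γ hγ
    exact key lam (h.trans e)
  · obtain ⟨γ, hγ, -⟩ := key (G.s β) (G.r_s β).symm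
    obtain ⟨_, _, h, _⟩ := hr γ hγ
    exact ⟨γ, hγ, h.symm⟩

end PGraph

/-! ### Filters: topology, shifts and limits -/

namespace FilterPath

variable {Q : Type*} [Group Q] {P : Submonoid Q} {Λ : Type*} {G : PGraph P Λ}

theorem isClopen_setOf_mem (lam : Λ) : IsClopen {x : FilterPath G | lam ∈ x.carrier} := by
  constructor
  · refine ⟨TopologicalSpace.isOpen_generateFrom_of_mem
      ⟨∅, {lam}, Set.finite_empty, Set.finite_singleton _, ?_⟩⟩
    ext x
    simp
  · refine TopologicalSpace.isOpen_generateFrom_of_mem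
      ⟨{lam}, ∅, Set.finite_singleton _, Set.finite_empty, ?_⟩
    ext x
    simp

theorem continuous_of_isClopen {Y : Type*} [TopologicalSpace Y] {f : Y → FilterPath G}
    (h : ∀ lam, IsClopen {y | lam ∈ (f y).carrier}) : Continuous f := by
  refine continuous_generateFrom_iff.2 ?_
  rintro _ ⟨K₁, K₂, h₁, h₂, rfl⟩
  have e : f ⁻¹' {x | K₁ ⊆ x.carrier ∧ x.carrier ⊆ K₂ᶜ} =
      (⋂ lam ∈ K₁, {y | lam ∈ (f y).carrier}) ∩ ⋂ lam ∈ K₂, {y | lam ∈ (f y).carrier}ᶜ := by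
    ext y
    simp only [Set.mem_preimage, Set.mem_ofPred_eq, Set.mem_inter_iff, Set.mem_iInter,
      Set.mem_compl_iff, Set.subset_compl_comm (s := (f y).carrier)]
    rfl
  rw [e]
  exact (h₁.isOpen_biInter fun lam _ => (h lam).isOpen).inter
    (h₂.isOpen_biInter fun lam _ => (h lam).compl.isOpen)

theorem isClopen_setOf_mem_shift (μ lam : Λ) :
    IsClopen {x : {x : FilterPath G // μ ∈ x.carrier} | lam ∈ (x.1.shift μ x.2).carrier} := by
  by_cases h : G.s μ = G.r lam
  · convert (isClopen_setOf_mem (G := G) (G.comp μ lam h)).preimage continuous_subtype_val using 1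
    ext x
    exact ⟨fun hx => hx.2, fun hx => ⟨h, hx⟩⟩
  · convert isClopen_empty using 1
    ext x
    exact ⟨fun hx => h hx.1, False.elim⟩

/-- By directedness, every element of `x` lies below some `μα ∈ x`, so `x` is the hereditary closure
of `μ` times its shift. -/
theorem shift_injective {x y : FilterPath G} {μ : Λ} (hx : μ ∈ x.carrier) (hy : μ ∈ y.carrier)
    (e : x.shift μ hx = y.shift μ hy) : x = y := by
  have key : ∀ {x y : FilterPath G} (hx : μ ∈ x.carrier) (hy : μ ∈ y.carrier),
      x.shift μ hx = y.shift μ hy → x.carrier ⊆ y.carrier := by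
    intro x y hx hy e lam hlam
    obtain ⟨_, hκ, ⟨α, hα, rfl⟩, h⟩ := x.directed μ hx lam hlam
    have : α ∈ (x.shift μ hx).carrier := ⟨hα, hκ⟩
    rw [e] at this
    exact y.hereditary _ _ h this.2
  exact FilterPath.ext ((key hx hy e).antisymm (key hy hx e.symm))

/-- The domain of `m` is covered by the clopen sets of filters containing a fixed `μ` of degree `m`;
on each of these the action is the shift by `μ`, which is continuous and injective. -/
theorem isContinuousLocallyInjective_filterAction (G : PGraph P Λ) :
    (filterAction G).IsContinuousLocallyInjective where
  isOpen_preimage m W hW := by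
    have e : {x : FilterPath G | ∃ h : (filterAction G).dom x m, (filterAction G).act x m h ∈ W} =
        ⋃ μ : {μ // G.d μ = m}, Subtype.val ''
          ((fun x : {x : FilterPath G // μ.1 ∈ x.carrier} => x.1.shift μ.1 x.2) ⁻¹' W) := by
      ext x
      simp only [Set.mem_ofPred_eq, Set.mem_iUnion]
      constructor
      · rintro ⟨h, hW⟩
        obtain ⟨μ, hμ, hd⟩ := id h
        refine ⟨⟨μ, hd⟩, ⟨x, hμ⟩, ?_, rfl⟩
        change x.act m h ∈ W at hW
        rwa [x.act_eq m h μ hμ hd] at hW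
      · rintro ⟨⟨μ, hd⟩, ⟨x, hμ⟩, hW, rfl⟩
        have h : x.Dom m := ⟨μ, hμ, hd⟩
        refine ⟨h, ?_⟩
        change x.act m h ∈ W
        rwa [x.act_eq m h μ hμ hd]
    rw [e]
    exact isOpen_iUnion fun μ => (isClopen_setOf_mem μ.1).isOpen.isOpenMap_subtype_val _
      (hW.preimage (continuous_of_isClopen (isClopen_setOf_mem_shift μ.1)))
  exists_injective_nhd := by
    rintro x m ⟨μ, hμ, hd⟩
    refine ⟨_, (isClopen_setOf_mem μ).isOpen, hμ, fun y hy z hz hy' hz' e => ?_⟩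
    change y.act m hy' = z.act m hz' at e
    rw [y.act_eq m hy' μ hy hd, z.act_eq m hz' μ hz hd] at e
    exact shift_injective hy hz e

theorem exists_seq [Countable Λ] (x : FilterPath G) {μ : Λ} (hμ : μ ∈ x.carrier) :
    ∃ κ : ℕ → Λ, (∀ n, κ n ∈ x.carrier) ∧ (∀ i j, i ≤ j → G.Prec (κ i) (κ j)) ∧
      (∀ n, G.Prec μ (κ n)) ∧ ∀ lam ∈ x.carrier, ∃ n, G.Prec lam (κ n) := by
  -- The sequence is built in the part of `x` above `μ`, which is countable, directed and cofinal in
  -- `x`.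
  have : Encodable {lam // lam ∈ x.carrier ∧ G.Prec μ lam} := Encodable.ofCountable _
  have : Inhabited {lam // lam ∈ x.carrier ∧ G.Prec μ lam} := ⟨⟨μ, hμ, G.prec_refl μ⟩⟩
  have hd : Directed G.Prec (Subtype.val : {lam // lam ∈ x.carrier ∧ G.Prec μ lam} → Λ) := by
    rintro ⟨a, ha, ha'⟩ ⟨b, hb, hb'⟩
    obtain ⟨c, hc, h₁, h₂⟩ := x.directed a ha b hb
    exact ⟨⟨c, hc, G.prec_trans ha' h₁⟩, h₁, h₂⟩
  refine ⟨fun n => (hd.sequence _ n).1, fun n => (hd.sequence _ n).2.1, fun i j hij => ?_,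
    fun n => (hd.sequence _ n).2.2, fun lam hlam => ?_⟩
  · induction hij with
    | refl => exact G.prec_refl _
    | step _ ih => exact G.prec_trans ih (hd.sequence_mono_nat _)
  · obtain ⟨c, hc, h₁, h₂⟩ := x.directed μ hμ lam hlam
    exact ⟨_, G.prec_trans h₂ (hd.rel_sequence ⟨c, hc, h₁⟩)⟩

/-- The filter of all initial segments of an arrow. -/
def principal (G : PGraph P Λ) (lam : Λ) : FilterPath G where
  carrier := {μ | G.Prec μ lam}
  nonempty := ⟨lam, G.prec_refl lam⟩
  hereditary _ _ h h' := G.prec_trans h h'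
  directed _ hμ _ hν := ⟨lam, G.prec_refl lam, hμ, hν⟩

/-- The limit of a family of filters along an ultrafilter. -/
def ultralimit {ι : Type*} (hG : G.IsFinitelyAligned) (U : Ultrafilter ι) (f : ι → FilterPath G)
    (hne : ∃ lam, ∀ᶠ i in U, lam ∈ (f i).carrier) : FilterPath G where
  carrier := {lam | ∀ᶠ i in U, lam ∈ (f i).carrier}
  nonempty := hne
  hereditary lam μ h hμ := hμ.mono fun i hi => (f i).hereditary lam μ h hi
  directed μ hμ ν hν := by
    obtain ⟨J, hJ, e⟩ := hG μ ν
    -- By finite alignment, almost every `f i` contains a member of the finite set `J` of common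
    -- extensions; the ultrafilter selects a single one.
    obtain ⟨σ, hσ, h⟩ := U.exists_mem_eventually_of_finite hJ
        (p := fun σ i => σ ∈ (f i).carrier) <| by
      filter_upwards [hμ, hν] with i h₁ h₂
      obtain ⟨κ, hκ, h₃, h₄⟩ := (f i).directed _ h₁ _ h₂
      have : κ ∈ G.ideal μ ∩ G.ideal ν := ⟨h₃, h₄⟩
      rw [e] at this
      simp only [Set.mem_iUnion] at this
      obtain ⟨σ, hσ, h⟩ := this
      exact ⟨σ, hσ, (f i).hereditary _ _ h hκ⟩
    have : σ ∈ G.ideal μ ∩ G.ideal ν := by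
      rw [e]
      exact Set.mem_biUnion hσ (G.prec_refl σ)
    exact ⟨σ, h, this⟩

/-! ### Maximal filters, tight filters and the boundary -/

/-- Filters that are maximal with respect to inclusion. -/
def IsUltra (x : FilterPath G) : Prop := ∀ y : FilterPath G, x.carrier ⊆ y.carrier → x = y

theorem exists_isUltra (G : PGraph P Λ) (lam : Λ) :
    ∃ x : FilterPath G, x.IsUltra ∧ lam ∈ x.carrier := by
  have hub : ∀ c ⊆ Set.range (carrier (G := G)), IsChain (· ⊆ ·) c → c.Nonempty →
      ∃ ub ∈ Set.range (carrier (G := G)), ∀ s ∈ c, s ⊆ ub := by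
    rintro c hc hch ⟨a, ha⟩
    refine ⟨⋃₀ c, ⟨⟨⋃₀ c, ?_, ?_, ?_⟩, rfl⟩, fun s hs => Set.subset_sUnion_of_mem hs⟩
    · obtain ⟨x, rfl⟩ := hc ha
      exact x.nonempty.mono (Set.subset_sUnion_of_mem ha)
    · rintro lam μ h ⟨s, hs, hμ⟩
      obtain ⟨x, rfl⟩ := hc hs
      exact ⟨_, hs, x.hereditary _ _ h hμ⟩
    · rintro μ ⟨s, hs, hμ⟩ ν ⟨t, ht, hν⟩
      obtain ⟨u, hu, hsu, htu⟩ := hch.directedOn s hs t ht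
      obtain ⟨x, rfl⟩ := hc hu
      obtain ⟨κ, hκ, h⟩ := x.directed μ (hsu hμ) ν (htu hν)
      exact ⟨κ, ⟨_, hu, hκ⟩, h⟩
  obtain ⟨_, hm, ⟨x, rfl⟩, hmax⟩ := zorn_subset_nonempty _ hub _ ⟨principal G lam, rfl⟩
  exact ⟨x, fun y hy => FilterPath.ext (hy.antisymm (hmax ⟨y, rfl⟩ hy)), hm (G.prec_refl lam)⟩

/-- Filters that pass through every finite exhaustive set at the source of each of their
elements. -/
def IsTight (x : FilterPath G) : Prop :=
  ∀ (μ : Λ) (hμ : μ ∈ x.carrier) (E : Set Λ), E.Finite → G.IsExhaustive E → G.s μ ∈ G.r '' E →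
    ∃ ν ∈ E, ν ∈ (x.shift μ hμ).carrier

/-- For fixed `μ` and `E` the condition reads "`μ ∉ x` or `μν ∈ x` for some `ν ∈ E`", a finite union
of clopen sets because `E` is finite. -/
theorem isClosed_setOf_isTight (G : PGraph P Λ) : IsClosed {x : FilterPath G | x.IsTight} := by
  have e : {x : FilterPath G | x.IsTight} = ⋂ (μ : Λ) (E : Set Λ) (_ : E.Finite)
      (_ : G.IsExhaustive E) (_ : G.s μ ∈ G.r '' E), {x : FilterPath G | μ ∈ x.carrier}ᶜ ∪
        ⋃ ν ∈ E, ⋃ h : G.s μ = G.r ν, {x : FilterPath G | G.comp μ ν h ∈ x.carrier} := by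
    ext x
    simp only [Set.mem_iInter, Set.mem_union, Set.mem_iUnion]
    constructor
    · intro hx μ E h₁ h₂ h₃
      by_cases hμ : μ ∈ x.carrier
      · obtain ⟨ν, hν, h, h'⟩ := hx μ hμ E h₁ h₂ h₃
        exact Or.inr ⟨ν, hν, h, h'⟩
      · exact Or.inl hμ
    · intro hx μ hμ E h₁ h₂ h₃
      rcases hx μ E h₁ h₂ h₃ with h | ⟨ν, hν, h, h'⟩
      · exact (h hμ).elim
      · exact ⟨ν, hν, h, h'⟩
  rw [e]
  refine isClosed_iInter fun μ => isClosed_iInter fun E => isClosed_iInter fun hE =>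
    isClosed_iInter fun _ => isClosed_iInter fun _ =>
    (isClopen_setOf_mem μ).compl.isClosed.union ?_
  exact hE.isClosed_biUnion fun ν _ => isClosed_iUnion_of_finite fun h =>
    (isClopen_setOf_mem _).isClosed

theorem IsTight.shift {x : FilterPath G} (hx : x.IsTight) {μ : Λ} (hμ : μ ∈ x.carrier) :
    (x.shift μ hμ).IsTight := by
  rintro α ⟨hα, hα'⟩ E h₁ h₂ h₃
  obtain ⟨ν, hν, h, h'⟩ := hx _ hα' E h₁ h₂ (by rwa [G.s_comp])
  have hαν : G.s α = G.r ν := by rw [← h, G.s_comp]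
  exact ⟨ν, hν, hαν, hα.trans (G.r_comp _ _ _).symm, by rwa [← G.assoc μ α ν hα hαν]⟩

/-- An exhaustive set at `lam` is moved to an element that the shift can see: for `μα = lam β` in
`x`, the set `E` is pulled back along `β`, and tightness of the shift is used at `α`. -/
theorem IsTight.of_shift (hG : G.IsFinitelyAligned) {x : FilterPath G} {μ : Λ}
    (hμ : μ ∈ x.carrier) (hx : (x.shift μ hμ).IsTight) : x.IsTight := by
  intro lam hlam E hE hex hs
  obtain ⟨σ, hσ, ⟨α, hα, rfl⟩, ⟨β, hβ, e⟩⟩ := x.directed μ hμ lam hlam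
  obtain ⟨F, hF, hF', hsF, hFE⟩ := hG.exists_exhaustive hE hex (β := β) (hβ ▸ hs)
  have hαβ : G.s α = G.s β := by rw [← G.s_comp μ α hα, ← e, G.s_comp]
  obtain ⟨γ, hγ, hαγ, h, hx'⟩ := hx α ⟨hα, hσ⟩ F hF hF' (hαβ ▸ hsF)
  obtain ⟨ν, hν, hβγ, hp⟩ := hFE γ hγ
  have hlν : G.s lam = G.r ν := by rw [hβ, ← G.r_eq_of_prec hp, G.r_comp]
  refine ⟨ν, hν, hlν, x.hereditary _ _
    (G.comp_prec_comp hp hlν (hβ.trans (G.r_comp _ _ _).symm)) ?_⟩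
  rw [← G.assoc lam β γ hβ hβγ]
  rw [← G.assoc μ α γ hα hαγ] at hx'
  rwa [G.comp_congr _ (by rw [G.s_comp, hαγ]) e rfl]

/-- Along a cofinal sequence `κ n` above `μ`, exhaustiveness gives `σ n` extending both `κ n` and
some `μν` with `ν ∈ E`. A limit of the principal filters of the `σ n` contains `x`, hence equals `x`
by maximality. -/
theorem IsUltra.isTight [Countable Λ] (hG : G.IsFinitelyAligned) {x : FilterPath G}
    (hx : x.IsUltra) : x.IsTight := by
  intro μ hμ E hE hex hs
  obtain ⟨κ, hκ, hmono, hμκ, hcof⟩ := x.exists_seq hμ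
  have hσ : ∀ n, ∃ σ, G.Prec (κ n) σ ∧ ∃ ν ∈ E, ∃ h : G.s μ = G.r ν, G.Prec (G.comp μ ν h) σ := by
    intro n
    obtain ⟨β, hβ, e⟩ := hμκ n
    obtain ⟨ν, hν, τ, h₁, h₂⟩ := hex β (hβ ▸ hs)
    have hτ : G.s μ = G.r τ := by rw [hβ, G.r_eq_of_prec h₁]
    have hν' : G.s μ = G.r ν := by rw [hτ, G.r_eq_of_prec h₂]
    exact ⟨G.comp μ τ hτ, e ▸ G.comp_prec_comp h₁ hβ hτ, ν, hν, hν', G.comp_prec_comp h₂ hν' hτ⟩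
  choose σ hσ₁ hσ₂ using hσ
  have hsub : ∀ lam ∈ x.carrier, ∀ᶠ n in (Filter.hyperfilter ℕ : Filter ℕ),
      lam ∈ (principal G (σ n)).carrier := by
    intro lam hlam
    obtain ⟨N, hN⟩ := hcof lam hlam
    refine Nat.hyperfilter_le_atTop ?_
    filter_upwards [Filter.eventually_ge_atTop N] with n hn
    exact G.prec_trans hN (G.prec_trans (hmono N n hn) (hσ₁ n))
  -- As `E` is finite, one `ν` serves for almost all `n`, so `μν` belongs to the limit.
  obtain ⟨ν, hν, hν'⟩ := (Filter.hyperfilter ℕ).exists_mem_eventually_of_finite hE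
    (Filter.Eventually.of_forall hσ₂)
  obtain ⟨-, h, -⟩ := hν'.exists
  have e := hx (ultralimit hG (Filter.hyperfilter ℕ) (fun n => principal G (σ n))
    ⟨μ, hsub μ hμ⟩) hsub
  refine ⟨ν, hν, h, ?_⟩
  rw [e]
  exact hν'.mono fun n hn => hn.2

theorem exists_upper_bound (x : FilterPath G) {K : Set Λ} (hK : K.Finite) (h : K ⊆ x.carrier) :
    ∃ μ ∈ x.carrier, ∀ lam ∈ K, G.Prec lam μ := by
  induction K, hK using Set.Finite.induction_on with
  | empty =>
    obtain ⟨μ, hμ⟩ := x.nonempty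
    exact ⟨μ, hμ, by simp⟩
  | @insert a K _ _ ih =>
    obtain ⟨μ, hμ, hK⟩ := ih ((Set.subset_insert a K).trans h)
    obtain ⟨κ, hκ, h₁, h₂⟩ := x.directed a (h (Set.mem_insert a K)) μ hμ
    refine ⟨κ, hκ, ?_⟩
    rintro lam (rfl | hlam)
    · exact h₁
    · exact G.prec_trans (hK lam hlam) h₂

theorem isTopologicalBasis (G : PGraph P Λ) : TopologicalSpace.IsTopologicalBasis
    {Z | ∃ K₁ K₂ : Set Λ, K₁.Finite ∧ K₂.Finite ∧
      Z = {x : FilterPath G | K₁ ⊆ x.carrier ∧ x.carrier ⊆ K₂ᶜ}} where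
  exists_subset_inter := by
    rintro _ ⟨K₁, K₂, h₁, h₂, rfl⟩ _ ⟨L₁, L₂, h₃, h₄, rfl⟩ x hx
    refine ⟨_, ⟨K₁ ∪ L₁, K₂ ∪ L₂, h₁.union h₃, h₂.union h₄, rfl⟩, ?_, ?_⟩
    · exact ⟨Set.union_subset hx.1.1 hx.2.1, by
        rw [Set.compl_union]; exact Set.subset_inter hx.1.2 hx.2.2⟩
    · rintro y ⟨hy₁, hy₂⟩
      rw [Set.compl_union] at hy₂
      exact ⟨⟨Set.subset_union_left.trans hy₁, hy₂.trans Set.inter_subset_left⟩,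
        ⟨Set.subset_union_right.trans hy₁, hy₂.trans Set.inter_subset_right⟩⟩
  sUnion_eq := by
    refine Set.eq_univ_of_forall fun x =>
      ⟨_, ⟨∅, ∅, Set.finite_empty, Set.finite_empty, rfl⟩, by simp⟩
  eq_generateFrom := rfl

/-- Let `μ ∈ x` bound `K₁`. The finitely many `γ` for which `μγ` reaches an element of `K₂` are all
missed by the shift of `x`, so by tightness some `lam` at `s μ` has no common extension with any of
them. A maximal filter through `μ lam` contains `K₁` and avoids `K₂`. -/
theorem IsTight.mem_filterBoundary (hG : G.IsFinitelyAligned) {x : FilterPath G}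
    (hx : x.IsTight) : x ∈ filterBoundary G := by
  refine (isTopologicalBasis G).mem_closure_iff.2 ?_
  rintro _ ⟨K₁, K₂, h₁, h₂, rfl⟩ ⟨hK₁, hK₂⟩
  obtain ⟨μ, hμ, hK⟩ := x.exists_upper_bound h₁ hK₁
  choose F hF hF₁ hF₂ using hG.exists_finite_extensions μ
  obtain ⟨lam, hlam, hdisj⟩ : ∃ lam, G.s μ = G.r lam ∧
      ∀ γ ∈ ⋃ κ ∈ K₂, F κ, ¬ (G.ideal lam ∩ G.ideal γ).Nonempty := by
    by_contra! hcon
    have hr : ∀ γ ∈ ⋃ κ ∈ K₂, F κ, ∃ κ ∈ K₂, ∃ h : G.s μ = G.r γ, G.Prec κ (G.comp μ γ h) := by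
      intro γ hγ
      simp only [Set.mem_iUnion] at hγ
      obtain ⟨κ, hκ, hγ⟩ := hγ
      exact ⟨κ, hκ, hF₁ κ γ hγ⟩
    -- The identity at `s μ` shows that the set of all `γ` is nonempty, so that `s μ` is in its
    -- range set.
    obtain ⟨γ, hγ, -⟩ := hcon (G.s μ) (G.r_s μ).symm
    obtain ⟨-, -, h, -⟩ := hr γ hγ
    obtain ⟨γ, hγ, h, hγ'⟩ := hx μ hμ (⋃ κ ∈ K₂, F κ) (h₂.biUnion fun κ _ => hF κ) (by
      rintro lam ⟨γ', hγ', e⟩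
      obtain ⟨-, -, h', -⟩ := hr γ' hγ'
      exact hcon lam (h'.trans e)) ⟨γ, hγ, h.symm⟩
    obtain ⟨κ, hκ, _, hp⟩ := hr γ hγ
    exact hK₂ (x.hereditary _ _ hp hγ') hκ
  obtain ⟨y, hy, hlamy⟩ := exists_isUltra G (G.comp μ lam hlam)
  refine ⟨y, ⟨fun κ hκ => y.hereditary _ _ (G.prec_trans (hK κ hκ) (G.prec_comp hlam)) hlamy,
    fun κ hκy hκ => ?_⟩, hy⟩
  -- If `κ ∈ K₂` were in `y`, a common extension of `μ lam` and `κ` would be some `μk` with `k`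
  -- extending both `lam` and one of the `γ`.
  obtain ⟨ρ, -, h₃, h₄⟩ := y.directed _ hlamy κ hκy
  obtain ⟨k, hk, rfl, h₅⟩ := G.exists_comp_of_comp_prec hlam h₃
  obtain ⟨γ, hγ, hγk⟩ := hF₂ κ k hk h₄
  exact hdisj γ (Set.mem_biUnion hκ hγ) ⟨k, h₅, hγk⟩

theorem mem_filterBoundary_iff [Countable Λ] (hG : G.IsFinitelyAligned) (x : FilterPath G) :
    x ∈ filterBoundary G ↔ x.IsTight :=
  ⟨fun hx => closure_minimal (fun _ hy => IsUltra.isTight hG hy) (isClosed_setOf_isTight G) hx,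
    fun hx => hx.mem_filterBoundary hG⟩

theorem isInvariant_setOf_isTight (hG : G.IsFinitelyAligned) :
    (filterAction G).IsInvariant {x | x.IsTight} := by
  intro x y m n hx hy hyt e
  obtain ⟨μ, hμ, hdμ⟩ := id hx
  obtain ⟨ν, hν, hdν⟩ := id hy
  change x.act m hx = y.act n hy at e
  rw [x.act_eq m hx μ hμ hdμ, y.act_eq n hy ν hν hdν] at e
  exact IsTight.of_shift hG hμ (e ▸ IsTight.shift hyt hν)

end FilterPath

/-! ### Graph morphisms and their filters -/

namespace MorphismPath

variable {Q : Type*} [Group Q] {P : Submonoid Q} {Λ : Type*} {G : PGraph P Λ}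

theorem toFun_congr (x : MorphismPath G) {z w : P × P} (e : z = w) (hz : z ∈ x.dom)
    (hw : w ∈ x.dom) : x.toFun ⟨z, hz⟩ = x.toFun ⟨w, hw⟩ := by
  subst e
  rfl

theorem mem_dom_iff (x : MorphismPath G) {p q : P} : (p, q) ∈ x.dom ↔ p ∣ q ∧ (1, q) ∈ x.dom := by
  obtain ⟨k, -, hd, -⟩ := x.exists_seq
  rw [hd, mem_omegaSet, mem_omegaSet]
  exact ⟨fun h => ⟨h.1, one_dvd _, h.2⟩, fun h => ⟨h.1, h.2.2⟩⟩

theorem dom_of_dvd (x : MorphismPath G) {p q : P} (h : p ∣ q) (hq : (1, q) ∈ x.dom) :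
    (1, p) ∈ x.dom := by
  obtain ⟨k, -, hd, -⟩ := x.exists_seq
  rw [hd, mem_omegaSet] at hq ⊢
  exact ⟨one_dvd _, hq.2.imp fun n hn => dvd_trans h hn⟩

theorem mul_d_toFun (x : MorphismPath G) {p q : P} (h : (p, q) ∈ x.dom) :
    p * G.d (x.toFun ⟨(p, q), h⟩) = q := by
  obtain ⟨D, f, k, hk, rfl, hf⟩ := x
  dsimp only at h hf ⊢
  have := congrArg Subtype.val (hf.map_d ⟨(p, q), h⟩)
  apply Subtype.ext
  rw [Submonoid.coe_mul]
  refine (congrArg _ this).trans ?_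
  exact mul_inv_cancel_left (p : Q) q

theorem d_toFun (x : MorphismPath G) {q : P} (h : (1, q) ∈ x.dom) :
    G.d (x.toFun ⟨(1, q), h⟩) = q := by
  rw [← one_mul (G.d _), x.mul_d_toFun h]

theorem comp_toFun (x : MorphismPath G) {p q r : P} (h₁ : (p, q) ∈ x.dom) (h₂ : (q, r) ∈ x.dom)
    (h₃ : (p, r) ∈ x.dom) :
    ∃ h : G.s (x.toFun ⟨(p, q), h₁⟩) = G.r (x.toFun ⟨(q, r), h₂⟩),
      G.comp (x.toFun ⟨(p, q), h₁⟩) (x.toFun ⟨(q, r), h₂⟩) h = x.toFun ⟨(p, r), h₃⟩ := by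
  obtain ⟨D, f, k, hk, rfl, hf⟩ := x
  dsimp only at h₁ h₂ h₃ hf ⊢
  have h : G.s (f ⟨(p, q), h₁⟩) = G.r (f ⟨(q, r), h₂⟩) :=
    (hf.map_s ⟨(p, q), h₁⟩).symm.trans (hf.map_r ⟨(q, r), h₂⟩)
  exact ⟨h, (hf.map_comp ⟨(p, q), h₁⟩ ⟨(q, r), h₂⟩ rfl h).symm⟩

theorem mem_initialSet_iff (x : MorphismPath G) {lam : Λ} :
    lam ∈ x.initialSet ↔ ∃ h : (1, G.d lam) ∈ x.dom, x.toFun ⟨(1, G.d lam), h⟩ = lam := by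
  constructor
  · rintro ⟨q, h, rfl⟩
    have e := x.d_toFun h
    exact ⟨by rwa [e], x.toFun_congr (by rw [e]) _ _⟩
  · rintro ⟨h, e⟩
    exact ⟨_, h, e⟩

theorem toFun_prec_toFun (x : MorphismPath G) {p q : P} (h : p ∣ q) (hp : (1, p) ∈ x.dom)
    (hq : (1, q) ∈ x.dom) : G.Prec (x.toFun ⟨(1, p), hp⟩) (x.toFun ⟨(1, q), hq⟩) :=
  ⟨_, x.comp_toFun hp (x.mem_dom_iff.2 ⟨h, hq⟩) hq⟩

/-- The filter of all values `x(e, q)`. -/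
def toFilter (x : MorphismPath G) : FilterPath G where
  carrier := x.initialSet
  nonempty := by
    obtain ⟨k, -, hd, -⟩ := x.exists_seq
    exact ⟨_, 1, by rw [hd, mem_omegaSet]; exact ⟨one_dvd _, 0, one_dvd _⟩, rfl⟩
  hereditary := by
    rintro lam _ ⟨ν, h, e⟩ ⟨q, hq, rfl⟩
    have hd : q = G.d lam * G.d ν := by rw [← G.d_comp _ _ h, e, x.d_toFun]
    have hdvd : G.d lam ∣ q := ⟨_, hd⟩
    have hl := x.dom_of_dvd hdvd hq
    -- Both `lam` and `x(e, d(lam))` are initial segments of `x(e, q)` of the same degree, so unique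
    -- factorisation identifies them.
    obtain ⟨h', e'⟩ := x.comp_toFun hl (x.mem_dom_iff.2 ⟨hdvd, hq⟩) hq
    exact ⟨_, hl, (G.fact_unique h' h (e'.trans e.symm) (x.d_toFun hl)).1⟩
  directed := by
    rintro _ ⟨p, hp, rfl⟩ _ ⟨q, hq, rfl⟩
    obtain ⟨k, hk, hd, -⟩ := x.exists_seq
    have hmono : ∀ i j, i ≤ j → k i ∣ k j := by
      intro i j hij
      rcases hij.eq_or_lt with rfl | h
      · exact dvd_rfl
      · exact hk i j h
    obtain ⟨i, hi⟩ := (mem_omegaSet.1 (hd ▸ hp)).2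
    obtain ⟨j, hj⟩ := (mem_omegaSet.1 (hd ▸ hq)).2
    have h : (1, k (max i j)) ∈ x.dom := by
      rw [hd, mem_omegaSet]
      exact ⟨one_dvd _, _, dvd_rfl⟩
    exact ⟨_, ⟨_, h, rfl⟩, x.toFun_prec_toFun (dvd_trans hi (hmono _ _ (le_max_left _ _))) hp h,
      x.toFun_prec_toFun (dvd_trans hj (hmono _ _ (le_max_right _ _))) hq h⟩

theorem dom_toFilter_iff (x : MorphismPath G) (m : P) : x.toFilter.Dom m ↔ (1, m) ∈ x.dom := by
  constructor
  · rintro ⟨_, ⟨q, hq, rfl⟩, rfl⟩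
    rwa [x.d_toFun]
  · intro h
    exact ⟨_, ⟨m, h, rfl⟩, x.d_toFun h⟩

/-- The value `x(e, q)` is the only element of degree `q` in the filter, and cancelling `x(e, p)`
from `x(e, q)` leaves `x(p, q)`. -/
theorem toFilter_injective : Function.Injective (toFilter (G := G)) := by
  intro x y e
  have h₁ : ∀ q, (1, q) ∈ x.dom ↔ (1, q) ∈ y.dom := fun q => by
    rw [← dom_toFilter_iff, ← dom_toFilter_iff, e]
  have h₂ : ∀ q hx hy, x.toFun ⟨(1, q), hx⟩ = y.toFun ⟨(1, q), hy⟩ := by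
    intro q hx hy
    have h : x.toFun ⟨(1, q), hx⟩ ∈ y.toFilter.carrier := e ▸ ⟨q, hx, rfl⟩
    exact y.toFilter.eq_of_d_eq h ⟨q, hy, rfl⟩ ((x.d_toFun hx).trans (y.d_toFun hy).symm)
  refine ext' (fun ⟨p, q⟩ => by rw [x.mem_dom_iff, y.mem_dom_iff, h₁]) ?_
  rintro ⟨p, q⟩ hx hy
  obtain ⟨hpq, hqx⟩ := x.mem_dom_iff.1 hx
  obtain ⟨-, hqy⟩ := y.mem_dom_iff.1 hy
  obtain ⟨c, ec⟩ := x.comp_toFun (x.dom_of_dvd hpq hqx) hx hqx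
  obtain ⟨c', ec'⟩ := y.comp_toFun (y.dom_of_dvd hpq hqy) hy hqy
  exact (G.fact_unique c c' (by rw [ec, ec', h₂]) (by rw [h₂])).2

/-- `ν` is the segment of the filter `x` between the degrees `p` and `q`. -/
def IsSegment (x : FilterPath G) (p q : P) (ν : Λ) : Prop :=
  ∃ μ ∈ x.carrier, G.d μ = p ∧ ∃ h : G.s μ = G.r ν, G.comp μ ν h ∈ x.carrier ∧ p * G.d ν = q

theorem exists_isSegment (x : FilterPath G) {p q : P} (h : p ∣ q) (hq : x.Dom q) :
    ∃ ν, IsSegment x p q ν := by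
  obtain ⟨lam, hlam, rfl⟩ := hq
  obtain ⟨t, ht⟩ := h
  obtain ⟨⟨μ, ν⟩, ⟨⟨hμν, rfl⟩, hp, hν⟩, -⟩ := G.factorisation lam p t ht
  dsimp only at hμν hp hν hlam ht
  exact ⟨ν, μ, x.hereditary _ _ (G.prec_comp hμν) hlam, hp, hμν, hlam, by rw [ht, hν]⟩

theorem IsSegment.unique {x : FilterPath G} {p q : P} {ν ν' : Λ} (h : IsSegment x p q ν)
    (h' : IsSegment x p q ν') : ν = ν' := by
  obtain ⟨μ, hμ, hp, c, hc, hq⟩ := h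
  obtain ⟨μ', hμ', hp', c', hc', hq'⟩ := h'
  have e := x.eq_of_d_eq hc hc' (by rw [G.d_comp, G.d_comp, hp, hp', hq, hq'])
  exact (G.fact_unique c c' e (hp.trans hp'.symm)).2

theorem isSegment_one_iff {x : FilterPath G} {q : P} {ν : Λ} :
    IsSegment x 1 q ν ↔ ν ∈ x.carrier ∧ G.d ν = q := by
  constructor
  · rintro ⟨μ, hμ, hd, h, hc, hq⟩
    have e : G.comp μ ν h = ν :=
      (G.comp_congr h (G.s_r ν) (by rw [← h, ← G.eq_r_of_d_eq_one hd, G.s_r]) rfl).trans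
        (G.id_comp ν)
    exact ⟨e ▸ hc, by rw [← hq, one_mul]⟩
  · rintro ⟨hν, hd⟩
    exact ⟨G.r ν, x.hereditary _ _ (G.r_prec ν) hν, G.d_r ν, G.s_r ν, by rwa [G.id_comp],
      by rw [one_mul, hd]⟩

/-- The degrees of a cofinal sequence in the filter define the domain, and `(p, q)` is sent to the
segment between the degrees `p` and `q`. Each morphism axiom for ranges, sources and composites
follows from uniqueness of segments. -/
theorem toFilter_surjective [Countable Λ] : Function.Surjective (toFilter (G := G)) := by
  intro x
  obtain ⟨a, ha⟩ := x.nonempty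
  obtain ⟨κ, hκ, hmono, -, hcof⟩ := x.exists_seq ha
  have hdvd : ∀ {μ lam : Λ}, G.Prec μ lam → G.d μ ∣ G.d lam := by
    rintro μ _ ⟨ν, h, rfl⟩
    exact ⟨_, G.d_comp μ ν h⟩
  -- By cofinality the domain depends only on the degrees that occur in `x`.
  have hdom : ∀ z : P × P, z ∈ omegaSet (fun n => G.d (κ n)) ↔ z.1 ∣ z.2 ∧ x.Dom z.2 := by
    intro z
    rw [mem_omegaSet]
    refine and_congr_right fun _ => ⟨?_, ?_⟩
    · rintro ⟨n, t, ht⟩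
      have : x.Dom (z.2 * t) := ⟨κ n, hκ n, ht⟩
      exact (((filterAction G).dom_mul x z.2 t).1 this).1
    · rintro ⟨lam, hlam, e⟩
      obtain ⟨n, hn⟩ := hcof lam hlam
      exact ⟨n, e ▸ hdvd hn⟩
  have hseg : ∀ z : omegaSet (fun n => G.d (κ n)), ∃ ν, IsSegment x z.1.1 z.1.2 ν := fun z =>
    exists_isSegment x ((hdom z.1).1 z.2).1 ((hdom z.1).1 z.2).2
  choose f hf using hseg
  have hmor : (omega fun n => G.d (κ n)).IsMorphism G f := by
    refine ⟨fun z => ?_, fun z => ?_, ?_, fun z => ?_⟩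
    · obtain ⟨μ, hμ, hp, c, hc, hq⟩ := hf z
      have c' : G.s μ = G.r (G.r (f z)) := by rw [G.r_r, c]
      refine (hf _).unique ⟨μ, hμ, hp, c', ?_, by rw [G.d_r, mul_one]; rfl⟩
      rwa [G.comp_congr c' (G.r_s μ).symm rfl c.symm, G.comp_id]
    · obtain ⟨μ, hμ, hp, c, hc, hq⟩ := hf z
      have c' : G.s (G.comp μ (f z) c) = G.r (G.s (f z)) := by rw [G.r_s, G.s_comp]
      refine (hf _).unique ⟨_, hc, by rw [G.d_comp, hp, hq]; rfl, c', ?_,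
        by
          -- A source is its own range, hence has degree `1`.
          have := G.d_r (G.s (f z))
          rw [G.r_s] at this
          rw [this, mul_one]
          rfl⟩
      rwa [G.comp_congr c' (G.r_s _).symm rfl (G.s_comp _ _ _).symm, G.comp_id]
    · intro z w h h'
      have ezw : z.1.2 = w.1.1 := congrArg (fun t => t.1.1) h
      obtain ⟨μ, hμ, hp, c, hc, hq⟩ := hf z
      obtain ⟨μ', hμ', hp', c', hc', hq'⟩ := hf w
      have e : μ' = G.comp μ (f z) c :=
        x.eq_of_d_eq hμ' hc (by rw [G.d_comp, hp, hq, hp', ezw])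
      subst e
      refine (hf _).unique ⟨μ, hμ, hp, c.trans (G.r_comp _ _ _).symm, ?_, ?_⟩
      · rwa [← G.assoc μ (f z) (f w) c h']
      · rw [G.d_comp, ← mul_assoc]
        exact (congrArg (· * G.d (f w)) (hq.trans ezw)).trans hq'
    · obtain ⟨-, -, -, -, -, hq⟩ := hf z
      apply Subtype.ext
      have hq' : (z.1.1 : Q) * (G.d (f z) : Q) = z.1.2 := congrArg Subtype.val hq
      change (G.d (f z) : Q) = (z.1.1 : Q)⁻¹ * z.1.2
      rw [← hq', inv_mul_cancel_left]
  refine ⟨⟨omegaSet fun n => G.d (κ n), f, fun n => G.d (κ n),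
    fun i j hij => hdvd (hmono i j hij.le), rfl, hmor⟩, FilterPath.ext (Set.ext fun lam => ?_)⟩
  constructor
  · rintro ⟨q, hq, rfl⟩
    exact (isSegment_one_iff.1 (hf ⟨(1, q), hq⟩)).1
  · intro hlam
    have h : ((1, G.d lam) : P × P) ∈ omegaSet fun n => G.d (κ n) :=
      (hdom _).2 ⟨one_dvd _, lam, hlam, rfl⟩
    exact ⟨G.d lam, h, (hf ⟨_, h⟩).unique (isSegment_one_iff.2 ⟨hlam, rfl⟩)⟩

/-- The basic sets of morphisms are by definition the preimages of the basic sets of filters, so a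
bijection is all that is needed. -/
theorem isHomeomorph_toFilter [Countable Λ] : IsHomeomorph (toFilter (G := G)) := by
  refine isHomeomorph_iff_isEmbedding_surjective.2
    ⟨⟨⟨?_⟩, toFilter_injective⟩, toFilter_surjective⟩
  refine Eq.trans ?_ induced_generateFrom_eq.symm
  refine congrArg TopologicalSpace.generateFrom (Set.ext fun Z => ⟨?_, ?_⟩)
  · rintro ⟨K₁, K₂, h₁, h₂, rfl⟩
    exact ⟨_, ⟨K₁, K₂, h₁, h₂, rfl⟩, rfl⟩
  · rintro ⟨_, ⟨K₁, K₂, h₁, h₂, rfl⟩, rfl⟩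
    exact ⟨K₁, K₂, h₁, h₂, rfl⟩

/-- This dictionary between shifted filters and values `x(m, m d(ν))` serves both equivariance and
the comparison of the boundary conditions. It rests on cancelling `x(e, m)` from `x(e, m d(ν))`. -/
theorem mem_shift_toFilter_iff (x : MorphismPath G) {m : P} (hm : (1, m) ∈ x.dom)
    (h : x.toFun ⟨(1, m), hm⟩ ∈ x.toFilter.carrier) {ν : Λ} :
    ν ∈ (x.toFilter.shift _ h).carrier ↔
      ∃ h' : (m, m * G.d ν) ∈ x.dom, x.toFun ⟨(m, m * G.d ν), h'⟩ = ν := by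
  constructor
  · rintro ⟨c, hc⟩
    obtain ⟨hd, e⟩ := x.mem_initialSet_iff.1 hc
    have hd' : G.d (G.comp _ ν c) = m * G.d ν := by rw [G.d_comp, x.d_toFun]
    have h₂ : (1, m * G.d ν) ∈ x.dom := hd' ▸ hd
    have h₁ : (m, m * G.d ν) ∈ x.dom := x.mem_dom_iff.2 ⟨dvd_mul_right _ _, h₂⟩
    obtain ⟨c', e'⟩ := x.comp_toFun hm h₁ h₂
    refine ⟨h₁, G.comp_left_cancel c' c (e'.trans (Eq.trans ?_ e))⟩
    exact x.toFun_congr (by rw [hd']) _ _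
  · rintro ⟨h₁, e⟩
    have h₂ := (x.mem_dom_iff.1 h₁).2
    obtain ⟨c, e'⟩ := x.comp_toFun hm h₁ h₂
    have c' := c.trans (congrArg G.r e)
    exact ⟨c', _, h₂, e'.symm.trans (G.comp_congr c c' rfl e)⟩

theorem toFilter_act (x : MorphismPath G) {m : P} (hm : (1, m) ∈ x.dom)
    (h : x.toFun ⟨(1, m), hm⟩ ∈ x.toFilter.carrier) :
    (x.act m hm).toFilter = x.toFilter.shift _ h := by
  ext ν
  rw [mem_shift_toFilter_iff]
  refine (mem_initialSet_iff _).trans ?_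
  constructor
  · rintro ⟨h, e⟩
    have h' : (m * 1, m * G.d ν) ∈ x.dom := h
    exact ⟨by rwa [mul_one] at h', (x.toFun_congr (by rw [mul_one]) _ h').trans e⟩
  · rintro ⟨h, e⟩
    have h' : (m * 1, m * G.d ν) ∈ x.dom := by rwa [mul_one]
    exact ⟨h', (x.toFun_congr (by rw [mul_one]) h' _).trans e⟩

theorem isEquivariant_toFilter (G : PGraph P Λ) :
    (morphismAction G).IsEquivariant (filterAction G) toFilter where
  dom_iff x m := (x.dom_toFilter_iff m).symm
  map_act x m h h' :=
    (x.toFilter_act h ⟨m, h, rfl⟩).trans (x.toFilter.act_eq m h' _ _ (x.d_toFun h)).symm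

theorem isTight_toFilter_iff (x : MorphismPath G) :
    x.toFilter.IsTight ↔ x ∈ morphismBoundary G := by
  constructor
  · intro hx m hm E h₁ h₂ h₃
    obtain ⟨ν, hν, h⟩ := hx _ ⟨m, hm, rfl⟩ E h₁ h₂ h₃
    exact ⟨ν, hν, (x.mem_shift_toFilter_iff hm _).1 h⟩
  · rintro hx _ ⟨m, hm, rfl⟩ E h₁ h₂ h₃
    obtain ⟨ν, hν, h⟩ := hx m hm E h₁ h₂ h₃
    exact ⟨ν, hν, (x.mem_shift_toFilter_iff hm _).2 h⟩

end MorphismPath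

/-! ### The path groupoids and boundary-path groupoids are isomorphic -/

theorem mainTheorem1 {Q : Type*} [Group Q] (P : Submonoid Q)
    (hP : IsWeaklyQuasiLatticeOrdered P) {Λ : Type*} [Countable Λ] (G : PGraph P Λ)
    (hG : G.IsFinitelyAligned) :
    (morphismPathGroupoid hP G).IsTopological ∧ (filterPathGroupoid hP G).IsTopological ∧
    IsClosed (morphismBoundary G) ∧ (morphismAction G).IsInvariant (morphismBoundary G) ∧
    ∃ ψ : SemidirectArrows (morphismAction G) → SemidirectArrows (filterAction G),
      (∀ g, (ψ g).rng.carrier = g.rng.initialSet ∧ (ψ g).deg = g.deg ∧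
        (ψ g).src.carrier = g.src.initialSet) ∧
      ArrowGroupoid.IsTopIso (morphismPathGroupoid hP G) (filterPathGroupoid hP G) ψ ∧
      ∃ hψ : Set.MapsTo ψ (morphismBoundaryArrows hP G) (filterBoundaryArrows hP G),
        ArrowGroupoid.IsTopIso (morphismBoundaryGroupoid hP G) (filterBoundaryGroupoid hP G)
          hψ.restrict := by
  have hf := MorphismPath.isEquivariant_toFilter G
  have hh := MorphismPath.isHomeomorph_toFilter (G := G)
  have hiso : (morphismPathGroupoid hP G).IsTopIso (filterPathGroupoid hP G)
      (SemidirectArrows.map MorphismPath.toFilter hf) := SemidirectArrows.isTopIso_map _ _ hf hh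
  have htop : (filterPathGroupoid hP G).IsTopological := SemidirectArrows.isTopological_groupoid _
    (FilterPath.isContinuousLocallyInjective_filterAction G)
  have hpre : ∀ x : MorphismPath G, x.toFilter ∈ filterBoundary G ↔ x ∈ morphismBoundary G :=
    fun x => (FilterPath.mem_filterBoundary_iff hG _).trans x.isTight_toFilter_iff
  have hred : ∀ g, SemidirectArrows.map MorphismPath.toFilter hf g ∈ filterBoundaryArrows hP G ↔
      g ∈ morphismBoundaryArrows hP G := fun g =>
    (SemidirectArrows.mem_reductionSet_units _ _ _).trans
      ((and_congr (hpre g.src) (hpre g.rng)).trans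
        (SemidirectArrows.mem_reductionSet_units _ _ g).symm)
  refine ⟨hiso.isTopological htop, htop, ?_, ?_, _, fun g => ⟨rfl, rfl, rfl⟩, hiso,
    fun g hg => (hred g).2 hg, hiso.reduction _ fun g hg => (hred g).1 hg⟩
  · have e : morphismBoundary G = MorphismPath.toFilter ⁻¹' {x | x.IsTight} :=
      Set.ext fun x => x.isTight_toFilter_iff.symm
    rw [e]
    exact (FilterPath.isClosed_setOf_isTight G).preimage hh.continuous
  · intro x y m n hx hy hyU e
    refine x.isTight_toFilter_iff.1 (FilterPath.isInvariant_setOf_isTight hG _ _ m n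
      ((hf.dom_iff x m).1 hx) ((hf.dom_iff y n).1 hy) (y.isTight_toFilter_iff.2 hyU) ?_)
    rw [← hf.map_act x m hx, ← hf.map_act y n hy, e]
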